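/- There is a universal constant $C>0$ with the following property. Let $A_1,\dots,A_Q\in\mathbb R^{m\times d}$ ($Q\ge 1$), $b\in\mathbb R^m$, $\varepsilon\ge 0$ and $0<\delta<1$. For a matrix $A\in\mathbb R^{m\times p}$, the $\varepsilon$-ridge leverage score of row $i$ is $$\tau_{i,\varepsilon}(A)=\max_{\alpha\in\mathbb R^p,\ \alpha\ne 0}\frac{|(A\alpha)_i|^2}{\|A\alpha\|_2^2+\varepsilon\|\alpha\|_2^2}\qquad(\text{with } 0/0:=0).$$ Let $\tilde\tau_1,\dots,\tilde\tau_m$ be real numbers with $\tilde\tau_i\ge\tau_{i,\varepsilon}([A_j,A_k])$ for every row $i$ and all $j,k\in\{1,\dots,Q\}$, where $[A_j,A_k]\in\mathbb R^{m\times 2d}$ is the horizontal concatenation, and let $\tilde s=\sum_{i=1}^m\tilde\tau_i$, with $\tilde s>0$. Let $$n\ \ge\ C\,\tilde s\,\max\{1,\log(\tilde s\,Q/\delta)\},$$ draw rows $r_1,\dots,r_n\in\{1,\dots,m\}$ independently with $\Pr[r_j=i]=\tilde\tau_i/\tilde s$, and let $S\in\mathbb R^{n\times m}$ be the sample-and-rescale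 matrix $S_{j,i}=\sqrt{\tilde s/(n\tilde\tau_i)}\;\mathbf 1[r_j=i]$. Then, with probability at least $1-\delta$, the subsampled problem $$\min_{k\in\{1,\dots,Q\},\ x\in\mathbb R^d}\ \|SA_kx-Sb\|_2^2+\varepsilon\|x\|_2^2$$ has a minimizer, and every minimizer $(\tilde k,\tilde x)$ of it satisfies $$\|A_{\tilde k}\tilde x-b\|_2^2+\varepsilon\|\tilde x\|_2^2\ \le\ \Big(9+\frac8\delta\Big)\min_{k\in\{1,\dots,Q\}}\ \min_{x\in\mathbb R^d}\Big(\|A_kx-b\|_2^2+\varepsilon\|x\|_2^2\Big).$$ -/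

import Mathlib

open MeasureTheory ProbabilityTheory Matrix

noncomputable section

namespace MultipleDesigns

/-- The squared Euclidean norm of a real vector. -/
def sqNorm {ι : Type*} [Fintype ι] (v : ι → ℝ) : ℝ :=
  ‖(WithLp.toLp 2 v : EuclideanSpace ℝ ι)‖ ^ 2

theorem sqNorm_eq_sum {ι : Type*} [Fintype ι] (v : ι → ℝ) : sqNorm v = ∑ i, v i ^ 2 := by
  simp [sqNorm, EuclideanSpace.norm_sq_eq]

/-- The `ε`-ridge leverage score of row `i` of `A`: the maximum over nonzero `α` of
`|(A α)_i|² / (‖A α‖² + ε ‖α‖²)`. If `ε = 0`, vectors `α` with `A α = 0` contribute `0`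
(the usual convention for `0 / 0` here). -/
def ridgeLeverage {ι κ : Type*} [Fintype ι] [Fintype κ] (ε : ℝ) (A : Matrix ι κ ℝ) (i : ι) : ℝ :=
  ⨆ α : {α : κ → ℝ // α ≠ 0},
    |(A *ᵥ α.1) i| ^ 2 / (sqNorm (A *ᵥ α.1) + ε * sqNorm α.1)

/-- The supremum defining the score ranges over a set that is bounded by `1`. -/
theorem ridgeLeverage_bddAbove {ι κ : Type*} [Fintype ι] [Fintype κ] {ε : ℝ} (hε : 0 ≤ ε)
    (A : Matrix ι κ ℝ) (i : ι) :
    BddAbove (Set.range fun α : {α : κ → ℝ // α ≠ 0} =>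
      |(A *ᵥ α.1) i| ^ 2 / (sqNorm (A *ᵥ α.1) + ε * sqNorm α.1)) := by
  refine ⟨1, ?_⟩
  rintro _ ⟨α, rfl⟩
  have h1 : 0 ≤ ε * sqNorm α.1 := mul_nonneg hε (by unfold sqNorm; positivity)
  have h2 : |(A *ᵥ α.1) i| ^ 2 ≤ sqNorm (A *ᵥ α.1) := by
    rw [sqNorm_eq_sum, sq_abs]
    exact Finset.single_le_sum (f := fun i => (A *ᵥ α.1) i ^ 2)
      (fun j _ => sq_nonneg _) (Finset.mem_univ i)
  have h3 : 0 ≤ |(A *ᵥ α.1) i| ^ 2 := by positivity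
  exact div_le_one_of_le₀ (by linarith) (by linarith)

/-- The ridge regression cost `‖A x - b‖² + ε ‖x‖²`. -/
def ridgeCost {ι κ : Type*} [Fintype ι] [Fintype κ] (ε : ℝ) (A : Matrix ι κ ℝ) (b : ι → ℝ)
    (x : κ → ℝ) : ℝ :=
  sqNorm (A *ᵥ x - b) + ε * sqNorm x

/-- `(k, x)` minimizes the ridge cost jointly over the choice of the design matrix and of the
coefficient vector. -/
def IsRidgeArgmin {Q : ℕ} {ι κ : Type*} [Fintype ι] [Fintype κ] (ε : ℝ)
    (A : Fin Q → Matrix ι κ ℝ) (b : ι → ℝ) (k : Fin Q) (x : κ → ℝ) : Prop :=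
  ∀ (k' : Fin Q) (x' : κ → ℝ), ridgeCost ε (A k) b x ≤ ridgeCost ε (A k') b x'

/-- The sample-and-rescale matrix of the rows `r 0, …, r (n - 1)` drawn with weights `τ`. -/
def sampleMatrix {m n : ℕ} (τ : Fin m → ℝ) (r : Fin n → Fin m) : Matrix (Fin n) (Fin m) ℝ :=
  Matrix.of fun j k => √((∑ i, τ i) / (n * τ k)) * (if r j = k then 1 else 0)

/-- The random rows `r 0, …, r (n - 1)` are drawn independently, each one equal to `i` with
probability proportional to `τ i`. -/
structure IsRowSample {m n : ℕ} {Ω : Type*} [MeasurableSpace Ω] (μ : Measure Ω)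
    (τ : Fin m → ℝ) (r : Fin n → Ω → Fin m) : Prop where
  measurable : ∀ j, Measurable (r j)
  indep : iIndepFun r μ
  law : ∀ j i, μ.real {ω | r j ω = i} = τ i / ∑ i', τ i'

end MultipleDesigns

end

/-!
The random quantities are functions of a finite sequence of sampled rows, so probabilities and
expectations are finite sums (`sampleProb`, `sampleWeight`), and `measureReal_eq_sampleProb`
transfers the result to the given probability space.

Fix a solution `(k₀, x₀)` of the full problem. Two events have to be excluded. First, the sketched
squared norm of its residual may exceed `5 / (4 δ)` times the true one; by Markov's inequality this
has probability at most `4 δ / 5`. Second, for some `k` the sketch may fail to preserve the ridge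
form of `[A k, A k₀]` from below up to the factor `3 / 4`; there are only `Q` such pairs, because
`k₀` does not depend on the sample. Outside both events, the triangle inequality applied to the
residuals of a sketched minimizer and of `(k₀, x₀)` gives the factor `9 + 8 / δ`
(`ridgeCost_le_of_sketch`).

The failure probability of one embedding is at most `3 s exp (-n / (128 s))` with `s = ∑ τ i`
(`sampleProb_not_embedding_le`). The prefactor `s`, in place of the ambient dimension, is what makes
`log (s Q / δ)` suffice, whatever the size of `s`. To obtain it, the ridge form is whitened
(`exists_whitening`), so that the rows become vectors `v i` with `|v i|² ≤ τ i` and Gram matrix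
`K ≤ 1` of trace at most `s`. The normalized deviation of the sampled Gram matrix from `K` is a sum
of independent centred bounded matrices of variance at most a multiple of `K`. The growth of the
potential `tr (exp A - A - 1)`, which vanishes at `A = 0`, is controlled one sample at a time
(`sum_trace_expExcess_add_le`) by the Golden–Thompson inequality `tr exp (A + B) ≤ tr (exp A exp B)`
and by `exp B ≤ 1 + B + B²`.

Golden–Thompson (`trace_exp_add_le`) follows from the Lie–Trotter formula and the inequality
`tr ((X Y) ^ N) ≤ tr (X ^ N Y ^ N)` for symmetric `X`, `Y` and `N` a power of two, which is an
iterated Cauchy–Schwarz inequality (`trace_pow_two_pow_le`).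
-/

noncomputable section

namespace MultipleDesigns

/-! ### The Lie–Trotter product formula -/

section LieTrotter

open NormedSpace Filter Topology

variable {𝔸 : Type*} [NormedRing 𝔸]

theorem norm_pow_sub_pow_le [NormOneClass 𝔸] {X Y : 𝔸} {M : ℝ} (hM : 1 ≤ M) (hX : ‖X‖ ≤ M)
    (hY : ‖Y‖ ≤ M) (k : ℕ) : ‖X ^ k - Y ^ k‖ ≤ k * M ^ k * ‖X - Y‖ := by
  induction k with
  | zero => simp
  | succ k ih =>
    have h1 : X ^ (k + 1) - Y ^ (k + 1) = X ^ k * (X - Y) + (X ^ k - Y ^ k) * Y := by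
      rw [pow_succ, pow_succ]; noncomm_ring
    have hM0 : 0 ≤ M := by linarith
    have h2 : ‖X ^ k‖ ≤ M ^ k := (norm_pow_le X k).trans (by gcongr)
    have h3 : M ^ k ≤ M ^ (k + 1) := pow_le_pow_right₀ hM (by omega)
    calc ‖X ^ (k + 1) - Y ^ (k + 1)‖ ≤ ‖X ^ k * (X - Y)‖ + ‖(X ^ k - Y ^ k) * Y‖ := by
          rw [h1]; exact norm_add_le _ _
      _ ≤ ‖X ^ k‖ * ‖X - Y‖ + ‖X ^ k - Y ^ k‖ * ‖Y‖ := by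
          gcongr <;> exact norm_mul_le _ _
      _ ≤ M ^ (k + 1) * ‖X - Y‖ + (k * M ^ k * ‖X - Y‖) * M := by
          gcongr; exact h2.trans h3
      _ = ((k + 1 : ℕ) : ℝ) * M ^ (k + 1) * ‖X - Y‖ := by push_cast; ring

variable [NormedAlgebra ℝ 𝔸] [CompleteSpace 𝔸]

theorem norm_exp_le_exp_norm [NormOneClass 𝔸] (x : 𝔸) : ‖exp x‖ ≤ Real.exp ‖x‖ := by
  have h1 := exp_series_hasSum_exp' (𝕂 := ℝ) x
  have h2 := norm_expSeries_summable' (𝕂 := ℝ) x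
  have h3 := exp_series_hasSum_exp' (𝕂 := ℝ) ‖x‖
  rw [← h1.tsum_eq, Real.exp_eq_exp_ℝ, ← h3.tsum_eq]
  refine (norm_tsum_le_tsum_norm h2).trans (h2.tsum_le_tsum (fun k => ?_) h3.summable)
  rw [norm_smul, smul_eq_mul, Real.norm_of_nonneg (by positivity)]
  gcongr
  exact norm_pow_le x k

/-- The **Lie–Trotter product formula**. -/
theorem tendsto_exp_mul_exp_pow [NormOneClass 𝔸] (A B : 𝔸) :
    Tendsto (fun k : ℕ => (exp ((k : ℝ)⁻¹ • A) * exp ((k : ℝ)⁻¹ • B)) ^ k) atTop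
      (𝓝 (exp (A + B))) := by
  let +nondep : NormedAlgebra ℚ 𝔸 := .restrictScalars ℚ ℝ 𝔸
  -- the difference of the two one-parameter families vanishes to second order at `0`
  set f : ℝ → 𝔸 := fun t => exp (t • A) * exp (t • B) - exp (t • (A + B)) with hf
  have hd : HasDerivAt f 0 0 := by
    have h := ((hasDerivAt_exp_smul_const (𝕂 := ℝ) A 0).mul
      (hasDerivAt_exp_smul_const (𝕂 := ℝ) B 0)).sub
      (hasDerivAt_exp_smul_const (𝕂 := ℝ) (A + B) 0)
    refine h.congr_deriv ?_
    simp
  have hf0 : f 0 = 0 := by simp [hf]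
  have hlim : Tendsto (fun k : ℕ => (k : ℝ) * ‖f (k : ℝ)⁻¹‖) atTop (𝓝 0) := by
    have h1 := hd.tendsto_slope_zero
    have h2 : Tendsto (fun k : ℕ => ((k : ℝ)⁻¹)) atTop (𝓝[≠] 0) := by
      refine tendsto_nhdsWithin_iff.2 ⟨tendsto_inv_atTop_nhds_zero_nat, ?_⟩
      filter_upwards [eventually_gt_atTop 0] with k hk
      simpa using hk.ne'
    have h3 := (h1.comp h2).norm
    simpa [Function.comp_def, hf0, norm_smul] using h3
  set c := ‖A‖ + ‖B‖
  have key : ∀ k : ℕ, 0 < k →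
      ‖(exp ((k : ℝ)⁻¹ • A) * exp ((k : ℝ)⁻¹ • B)) ^ k - exp (A + B)‖ ≤
        Real.exp c * (k * ‖f (k : ℝ)⁻¹‖) := by
    intro k hk
    have hk' : (0 : ℝ) < k := by exact_mod_cast hk
    have hsum : exp (A + B) = exp ((k : ℝ)⁻¹ • (A + B)) ^ k := by
      rw [← NormedSpace.exp_nsmul, ← Nat.cast_smul_eq_nsmul ℝ, smul_smul,
        mul_inv_cancel₀ hk'.ne', one_smul]
    have hn : ∀ Z : 𝔸, ‖(k : ℝ)⁻¹ • Z‖ = (k : ℝ)⁻¹ * ‖Z‖ := fun Z => by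
      rw [norm_smul, Real.norm_of_nonneg (by positivity)]
    have hX : ‖exp ((k : ℝ)⁻¹ • A) * exp ((k : ℝ)⁻¹ • B)‖ ≤ Real.exp ((k : ℝ)⁻¹ * c) := by
      refine (norm_mul_le _ _).trans ?_
      rw [mul_add, Real.exp_add, ← hn, ← hn]
      gcongr <;> exact norm_exp_le_exp_norm _
    have hY : ‖exp ((k : ℝ)⁻¹ • (A + B))‖ ≤ Real.exp ((k : ℝ)⁻¹ * c) := by
      refine (norm_exp_le_exp_norm _).trans (Real.exp_le_exp.2 ?_)
      rw [hn]
      gcongr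
      exact norm_add_le _ _
    have hM : 1 ≤ Real.exp ((k : ℝ)⁻¹ * c) := Real.one_le_exp (by positivity)
    have h := norm_pow_sub_pow_le hM hX hY k
    rw [← hsum, ← Real.exp_nat_mul, ← mul_assoc, mul_inv_cancel₀ hk'.ne', one_mul] at h
    refine h.trans (le_of_eq ?_)
    simp only [hf]; ring
  rw [tendsto_iff_norm_sub_tendsto_zero]
  refine squeeze_zero' (Eventually.of_forall fun k => norm_nonneg _)
    ((eventually_gt_atTop 0).mono key) ?_
  simpa using hlim.const_mul (Real.exp c)

end LieTrotter

/-! ### The Golden–Thompson inequality -/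

section GoldenThompson

open NormedSpace Filter Topology

variable {p : Type*} [Fintype p]

theorem trace_transpose_mul_eq_sum (X Y : Matrix p p ℝ) :
    (Xᵀ * Y).trace = ∑ i, ∑ j, X j i * Y j i := by
  simp [Matrix.trace, Matrix.mul_apply]

/-- The Cauchy–Schwarz inequality for the Hilbert–Schmidt inner product, in arithmetic-mean form. -/
theorem two_mul_trace_transpose_mul_le (X Y : Matrix p p ℝ) :
    2 * (Xᵀ * Y).trace ≤ (Xᵀ * X).trace + (Yᵀ * Y).trace := by
  simp only [trace_transpose_mul_eq_sum, Finset.mul_sum, ← Finset.sum_add_distrib]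
  gcongr with i _ j _
  nlinarith [sq_nonneg (X j i - Y j i)]

variable [DecidableEq p]

/-- The two trace inequalities behind Golden–Thompson, proved by a joint induction on the
exponent: each one feeds the other at the next power of two. -/
theorem trace_pow_two_pow_le (k : ℕ) :
    (∀ X Y : Matrix p p ℝ, Xᵀ = X → Yᵀ = Y →
      ((X * Y) ^ 2 ^ k).trace ≤ (X ^ 2 ^ k * Y ^ 2 ^ k).trace) ∧
    ∀ Z : Matrix p p ℝ, (Z ^ 2 ^ (k + 1)).trace ≤ ((Z * Zᵀ) ^ 2 ^ k).trace := by
  -- moving a factor to the front inside the trace of a power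
  have cyc : ∀ (n : ℕ) (U V : Matrix p p ℝ), ((U * V) ^ n).trace = ((V * U) ^ n).trace := by
    intro n U V
    rcases n with _ | n
    · simp
    · have h : ∀ j : ℕ, (U * V) ^ j * U = U * (V * U) ^ j := by
        intro j
        induction j with
        | zero => simp
        | succ j ih =>
          rw [pow_succ', Matrix.mul_assoc, ih, pow_succ' (V * U)]
          simp only [Matrix.mul_assoc]
      rw [pow_succ, ← Matrix.mul_assoc, h, Matrix.mul_assoc, Matrix.trace_mul_comm,
        Matrix.mul_assoc, ← pow_succ]
  induction k with
  | zero =>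
    refine ⟨fun X Y _ _ => by simp, fun Z => ?_⟩
    have h := two_mul_trace_transpose_mul_le Zᵀ Z
    rw [Matrix.transpose_transpose, Matrix.trace_mul_comm Zᵀ Z] at h
    simp only [zero_add, pow_one, pow_zero, pow_two]
    linarith
  | succ k ih =>
    obtain ⟨hF, hG⟩ := ih
    refine ⟨fun X Y hX hY => ?_, fun Z => ?_⟩
    · calc ((X * Y) ^ 2 ^ (k + 1)).trace ≤ ((X * Y * (X * Y)ᵀ) ^ 2 ^ k).trace := hG _
        _ = ((X * (Y * Y * X)) ^ 2 ^ k).trace := by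
            rw [Matrix.transpose_mul, hX, hY]; simp only [Matrix.mul_assoc]
        _ = ((Y ^ 2 * X ^ 2) ^ 2 ^ k).trace := by
            rw [cyc]; simp only [Matrix.mul_assoc, pow_two]
        _ = ((X ^ 2 * Y ^ 2) ^ 2 ^ k).trace := cyc _ _ _
        _ ≤ ((X ^ 2) ^ 2 ^ k * (Y ^ 2) ^ 2 ^ k).trace :=
            hF _ _ (by rw [Matrix.transpose_pow, hX]) (by rw [Matrix.transpose_pow, hY])
        _ = _ := by rw [← pow_mul, ← pow_mul, pow_succ' 2 k]
    · have hP : (Zᵀ * Z)ᵀ = Zᵀ * Z := by simp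
      have hQ : (Z * Zᵀ)ᵀ = Z * Zᵀ := by simp
      have h := two_mul_trace_transpose_mul_le ((Zᵀ * Z) ^ 2 ^ k) ((Z * Zᵀ) ^ 2 ^ k)
      rw [Matrix.transpose_pow, Matrix.transpose_pow, hP, hQ, ← pow_add, ← pow_add,
        ← two_mul, ← pow_succ', cyc _ Zᵀ Z] at h
      calc (Z ^ 2 ^ (k + 1 + 1)).trace = ((Z * Z) ^ 2 ^ (k + 1)).trace := by
            rw [← pow_two, ← pow_mul, pow_succ' 2 (k + 1)]
        _ ≤ ((Z * Z * (Z * Z)ᵀ) ^ 2 ^ k).trace := hG _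
        _ = ((Z * (Z * Zᵀ * Zᵀ)) ^ 2 ^ k).trace := by
            rw [Matrix.transpose_mul]; simp only [Matrix.mul_assoc]
        _ = ((Z * Zᵀ * (Zᵀ * Z)) ^ 2 ^ k).trace := by
            rw [cyc]; simp only [Matrix.mul_assoc]
        _ = ((Zᵀ * Z * (Z * Zᵀ)) ^ 2 ^ k).trace := cyc _ _ _
        _ ≤ ((Zᵀ * Z) ^ 2 ^ k * (Z * Zᵀ) ^ 2 ^ k).trace := hF _ _ hP hQ
        _ ≤ _ := by linarith

open scoped Matrix.Norms.Operator in
/-- The **Golden–Thompson inequality** for real symmetric matrices. -/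
theorem trace_exp_add_le {A B : Matrix p p ℝ} (hA : Aᵀ = A) (hB : Bᵀ = B) :
    (exp (A + B)).trace ≤ (exp A * exp B).trace := by
  cases isEmpty_or_nonempty p
  · simp [Matrix.trace]
  let +nondep : NormedAlgebra ℚ (Matrix p p ℝ) := .restrictScalars ℚ ℝ _
  have h1 := (tendsto_exp_mul_exp_pow A B).comp (tendsto_pow_atTop_atTop_of_one_lt one_lt_two)
  have h2 : Continuous fun M : Matrix p p ℝ => M.trace := continuous_id.matrix_trace
  refine le_of_tendsto ((h2.tendsto _).comp h1) (Eventually.of_forall fun k => ?_)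
  have hs : ∀ Z : Matrix p p ℝ, Zᵀ = Z →
      (exp (((2 ^ k : ℕ) : ℝ)⁻¹ • Z))ᵀ = exp (((2 ^ k : ℕ) : ℝ)⁻¹ • Z) := by
    intro Z hZ
    rw [← Matrix.exp_transpose, Matrix.transpose_smul, hZ]
  have hp : ∀ Z : Matrix p p ℝ, exp (((2 ^ k : ℕ) : ℝ)⁻¹ • Z) ^ 2 ^ k = exp Z := by
    intro Z
    rw [← Matrix.exp_nsmul, ← Nat.cast_smul_eq_nsmul ℝ, smul_smul,
      mul_inv_cancel₀ (by positivity), one_smul]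
  have h := (trace_pow_two_pow_le k).1 _ _ (hs A hA) (hs B hB)
  rw [hp, hp] at h
  exact h

end GoldenThompson

/-! ### Scalar inequalities transferred to symmetric matrices -/

section Transfer

variable {p : Type*}

theorem isHermitian_of_transpose_eq {A : Matrix p p ℝ} (hA : Aᵀ = A) : A.IsHermitian := by
  rw [Matrix.IsHermitian, Matrix.conjTranspose_eq_transpose_of_trivial, hA]

variable [Fintype p] [DecidableEq p]

/-- A combination of `1`, `A`, `A²` and `exp A` is positive semidefinite as soon as the
corresponding scalar function is nonnegative on the eigenvalues of `A`. -/
theorem posSemidef_quadratic_add_exp {A : Matrix p p ℝ} (hA : A.IsHermitian) (a b c e : ℝ)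
    (h : ∀ i, 0 ≤ a + b * hA.eigenvalues i + c * hA.eigenvalues i ^ 2 +
      e * Real.exp (hA.eigenvalues i)) :
    (a • (1 : Matrix p p ℝ) + b • A + c • A ^ 2 + e • NormedSpace.exp A).PosSemidef := by
  set U : Matrix p p ℝ := (hA.eigenvectorUnitary).1 with hU
  set D : Matrix p p ℝ := diagonal hA.eigenvalues with hD
  have hUU : U * star U = 1 := Unitary.coe_mul_star_self _
  have hUU' : star U * U = 1 := Unitary.coe_star_mul_self _
  have hinv : U⁻¹ = star U := Matrix.inv_eq_right_inv hUU
  have hunit : IsUnit U := IsUnit.of_mul_eq_one _ hUU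
  have hspec : A = U * D * star U := by
    have h := hA.spectral_theorem
    rw [Unitary.conjStarAlgAut_apply] at h
    exact h
  have hsq : A ^ 2 = U * D ^ 2 * star U := by
    rw [hspec, pow_two, pow_two]
    calc U * D * star U * (U * D * star U) = U * D * (star U * U) * D * star U := by
          noncomm_ring
      _ = _ := by rw [hUU']; noncomm_ring
  have hexp : NormedSpace.exp A = U * NormedSpace.exp D * star U := by
    rw [hspec, ← hinv, Matrix.exp_conj _ _ hunit]
  have key : a • (1 : Matrix p p ℝ) + b • A + c • A ^ 2 + e • NormedSpace.exp A =
      U * diagonal (fun i => a + b * hA.eigenvalues i + c * hA.eigenvalues i ^ 2 +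
        e * Real.exp (hA.eigenvalues i)) * Uᴴ := by
    have hdiag : diagonal (fun i => a + b * hA.eigenvalues i + c * hA.eigenvalues i ^ 2 +
        e * Real.exp (hA.eigenvalues i)) =
        a • (1 : Matrix p p ℝ) + b • D + c • D ^ 2 + e • NormedSpace.exp D := by
      rw [hD, Matrix.exp_diagonal, Matrix.diagonal_pow]
      ext i j
      rcases eq_or_ne i j with rfl | hij
      · simp [Pi.exp_def, Real.exp_eq_exp_ℝ]
      · simp [hij]
    rw [hdiag, hsq, hexp, ← Matrix.star_eq_conjTranspose]
    nth_rewrite 1 [hspec]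
    simp only [Matrix.mul_add, Matrix.add_mul, Matrix.mul_smul, Matrix.smul_mul]
    rw [Matrix.mul_one, hUU]
  rw [key]
  exact (Matrix.PosSemidef.diagonal h).mul_mul_conjTranspose_same U

theorem trace_mul_nonneg {P Q : Matrix p p ℝ} (hP : P.PosSemidef) (hQ : Q.PosSemidef) :
    0 ≤ (P * Q).trace := by
  open scoped MatrixOrder in
  obtain ⟨C, rfl⟩ := CStarAlgebra.nonneg_iff_eq_star_mul_self.mp hQ.nonneg
  rw [← Matrix.mul_assoc, Matrix.trace_mul_comm, ← Matrix.mul_assoc]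
  exact (hP.mul_mul_conjTranspose_same C).trace_nonneg

theorem trace_mul_le_trace_mul {P Q R : Matrix p p ℝ} (hP : P.PosSemidef)
    (hQR : (R - Q).PosSemidef) : (P * Q).trace ≤ (P * R).trace := by
  have h := trace_mul_nonneg hP hQR
  rw [Matrix.mul_sub, Matrix.trace_sub] at h
  linarith

theorem abs_eigenvalues_le {A : Matrix p p ℝ} (hA : A.IsHermitian) {c : ℝ}
    (h : ∀ x : p → ℝ, |x ⬝ᵥ A *ᵥ x| ≤ c * (x ⬝ᵥ x)) (i : p) : |hA.eigenvalues i| ≤ c := by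
  have h1 := hA.eigenvalues_eq i
  set v := hA.eigenvectorBasis i with hv
  have h2 : (⇑v : p → ℝ) ⬝ᵥ ⇑v = 1 := by
    have h3 : ‖v‖ = 1 := hA.eigenvectorBasis.orthonormal.1 i
    have h4 := EuclideanSpace.norm_sq_eq v
    rw [h3] at h4
    simp only [dotProduct, ← pow_two]
    simpa using h4.symm
  have h3 := h ⇑v
  rw [h2, mul_one] at h3
  rw [h1]
  simpa using h3

theorem posSemidef_exp {A : Matrix p p ℝ} (hA : Aᵀ = A) : (NormedSpace.exp A).PosSemidef := by
  have h := posSemidef_quadratic_add_exp (isHermitian_of_transpose_eq hA) 0 0 0 1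
    (fun i => by simpa using (Real.exp_pos _).le)
  simpa using h

/-- `exp B ≤ 1 + B + B²` for symmetric `B` with spectrum in `[-1, 1]`. -/
theorem posSemidef_one_add_add_sq_sub_exp {B : Matrix p p ℝ} (hB : Bᵀ = B)
    (h : ∀ x : p → ℝ, |x ⬝ᵥ B *ᵥ x| ≤ x ⬝ᵥ x) :
    (1 + B + B ^ 2 - NormedSpace.exp B).PosSemidef := by
  have h := posSemidef_quadratic_add_exp (isHermitian_of_transpose_eq hB) 1 1 1 (-1) (fun i => by
    have h1 := abs_eigenvalues_le (isHermitian_of_transpose_eq hB) (c := 1) (by simpa using h) i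
    have h2 := Real.norm_exp_sub_one_sub_id_le (x := _) (by rwa [Real.norm_eq_abs])
    rw [Real.norm_eq_abs, Real.norm_eq_abs, sq_abs] at h2
    linarith [(abs_le.1 h2).2])
  simpa [sub_eq_add_neg] using h

/-- The matrix `exp A - A - 1`, whose trace serves as the potential in the matrix tail bound.
Unlike `exp A` it vanishes at `A = 0`, so that the resulting bound involves the trace of the
variance proxy instead of the ambient dimension. -/
def expExcess (A : Matrix p p ℝ) : Matrix p p ℝ := NormedSpace.exp A - A - 1

theorem posSemidef_expExcess {A : Matrix p p ℝ} (hA : Aᵀ = A) : (expExcess A).PosSemidef := by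
  have h := posSemidef_quadratic_add_exp (isHermitian_of_transpose_eq hA) (-1) (-1) 0 1
    (fun i => by linarith [Real.add_one_le_exp ((isHermitian_of_transpose_eq hA).eigenvalues i)])
  convert h using 1
  simp only [expExcess, neg_smul, one_smul, zero_smul, add_zero]
  abel

theorem dotProduct_mulVec_le_trace_mul {E : Matrix p p ℝ} (hE : E.PosSemidef) (x : p → ℝ) :
    x ⬝ᵥ E *ᵥ x ≤ E.trace * (x ⬝ᵥ x) := by
  have h1 : ((x ⬝ᵥ x) • (1 : Matrix p p ℝ) - vecMulVec x x).PosSemidef := by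
    refine Matrix.PosSemidef.of_dotProduct_mulVec_nonneg ?_ fun y => ?_
    · refine isHermitian_of_transpose_eq ?_
      simp [Matrix.transpose_vecMulVec]
    · have hcs := Finset.sum_mul_sq_le_sq_mul_sq Finset.univ x y
      have hv : vecMulVec x x *ᵥ y = (x ⬝ᵥ y) • x := by
        rw [Matrix.vecMulVec_mulVec]; simp
      rw [Matrix.sub_mulVec, Matrix.smul_mulVec, Matrix.one_mulVec, dotProduct_sub, hv,
        dotProduct_smul, dotProduct_smul]
      simp only [star_trivial, smul_eq_mul]
      rw [dotProduct_comm y x]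
      simp only [dotProduct, ← pow_two] at hcs ⊢
      linarith
  have h2 := trace_mul_nonneg hE h1
  rw [Matrix.mul_sub, Matrix.trace_sub, Matrix.mul_smul, Matrix.mul_one, Matrix.trace_smul,
    Matrix.mul_vecMulVec, Matrix.trace_vecMulVec, smul_eq_mul] at h2
  rw [dotProduct_comm x]
  linarith

/-- A large value of the quadratic form of `A` forces a large trace of `expExcess A`. -/
theorem le_trace_expExcess {A : Matrix p p ℝ} (hA : Aᵀ = A) {t : ℝ} (ht : 0 ≤ t) {x : p → ℝ}
    (hx : t * (x ⬝ᵥ x) < x ⬝ᵥ A *ᵥ x) : Real.exp t - t - 1 ≤ (expExcess A).trace := by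
  have hx0 : 0 < x ⬝ᵥ x := by
    have h0 : 0 ≤ x ⬝ᵥ x := Finset.sum_nonneg fun i _ => mul_self_nonneg _
    refine h0.lt_of_ne fun h => ?_
    have : x = 0 := dotProduct_self_eq_zero.1 h.symm
    simp [this] at hx
  -- the tangent line of `exp y - y - 1` at `t` lies below the function
  have h := posSemidef_quadratic_add_exp (isHermitian_of_transpose_eq hA)
    (-(Real.exp t - t * Real.exp t)) (-Real.exp t) 0 1 (fun i => by
      set l := (isHermitian_of_transpose_eq hA).eigenvalues i
      have h1 : Real.exp l = Real.exp t * Real.exp (l - t) := by rw [← Real.exp_add]; ring_nf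
      have h2 := mul_le_mul_of_nonneg_left (Real.add_one_le_exp (l - t)) (Real.exp_pos t).le
      rw [h1]; linarith)
  have h2 := h.dotProduct_mulVec_nonneg x
  have h3 := dotProduct_mulVec_le_trace_mul (posSemidef_expExcess hA) x
  simp only [expExcess, Matrix.add_mulVec, Matrix.sub_mulVec, Matrix.smul_mulVec, dotProduct_add,
    dotProduct_sub, dotProduct_smul, star_trivial, Matrix.one_mulVec, smul_eq_mul, zero_mul,
    one_mul] at h2 h3
  have h4 := mul_le_mul_of_nonneg_left hx.le (sub_nonneg.2 (Real.one_le_exp ht))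
  refine le_of_mul_le_mul_right ?_ hx0
  simp only [expExcess]
  linarith

end Transfer

/-! ### Finite product distributions -/

section SampleProb

variable {ι : Type*} {n : ℕ}

/-- The weight of the sequence `ρ` under `n` independent draws from the weights `q`. -/
def sampleWeight (q : ι → ℝ) (ρ : Fin n → ι) : ℝ := ∏ j, q (ρ j)

theorem sampleWeight_nonneg {q : ι → ℝ} (hq : ∀ i, 0 ≤ q i) (ρ : Fin n → ι) :
    0 ≤ sampleWeight q ρ :=
  Finset.prod_nonneg fun j _ => hq (ρ j)

variable [Fintype ι]

/-- The total weight of a set of sequences under `n` independent draws from the weights `q`. -/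
def sampleProb (q : ι → ℝ) (E : Set (Fin n → ι)) : ℝ := ∑ ρ, E.indicator (sampleWeight q) ρ

theorem sum_sampleWeight_cons (q : ι → ℝ) (F : (Fin (n + 1) → ι) → ℝ) :
    ∑ ρ, sampleWeight q ρ * F ρ =
      ∑ ρ : Fin n → ι, sampleWeight q ρ * ∑ i, q i * F (Fin.cons i ρ) := by
  rw [← (Fin.consEquiv fun _ : Fin (n + 1) => ι).sum_comp, Fintype.sum_prod_type,
    Finset.sum_comm]
  refine Finset.sum_congr rfl fun ρ _ => ?_
  rw [Finset.mul_sum]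
  refine Finset.sum_congr rfl fun i _ => ?_
  have h : Fin.consEquiv (fun _ : Fin (n + 1) => ι) (i, ρ) = Fin.cons i ρ := rfl
  rw [h]
  simp only [sampleWeight, Fin.prod_univ_succ, Fin.cons_zero, Fin.cons_succ]
  ring

theorem sum_sampleWeight {q : ι → ℝ} (hq1 : ∑ i, q i = 1) :
    ∑ ρ : Fin n → ι, sampleWeight q ρ = 1 := by
  induction n with
  | zero => simp [sampleWeight]
  | succ n ih =>
    have h := sum_sampleWeight_cons (n := n) q fun _ => 1
    simpa [hq1, ih] using h

/-- The expectation of an additive statistic. -/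
theorem sum_sampleWeight_mul_sum {q : ι → ℝ} (hq1 : ∑ i, q i = 1) (f : ι → ℝ) :
    ∑ ρ : Fin n → ι, sampleWeight q ρ * ∑ j, f (ρ j) = n * ∑ i, q i * f i := by
  induction n with
  | zero => simp
  | succ n ih =>
    rw [sum_sampleWeight_cons]
    simp only [Fin.sum_univ_succ, Fin.cons_zero, Fin.cons_succ, mul_add, Finset.sum_add_distrib,
      ← Finset.sum_mul, hq1, one_mul, ih, sum_sampleWeight hq1]
    push_cast; ring

theorem sampleProb_mono {q : ι → ℝ} (hq : ∀ i, 0 ≤ q i) {E F : Set (Fin n → ι)} (h : E ⊆ F) :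
    sampleProb q E ≤ sampleProb q F :=
  Finset.sum_le_sum fun ρ _ =>
    Set.indicator_le_indicator_of_subset h (fun ρ => sampleWeight_nonneg hq ρ) ρ

theorem sampleProb_union_le {q : ι → ℝ} (hq : ∀ i, 0 ≤ q i) (E F : Set (Fin n → ι)) :
    sampleProb q (E ∪ F) ≤ sampleProb q E + sampleProb q F := by
  rw [sampleProb, sampleProb, sampleProb, ← Finset.sum_add_distrib]
  refine Finset.sum_le_sum fun ρ _ => ?_
  have h0 := sampleWeight_nonneg hq ρ
  by_cases hE : ρ ∈ E <;> by_cases hF : ρ ∈ F <;> simp [hE, hF, h0]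

theorem sampleProb_iUnion_le {κ : Type*} [Fintype κ] {q : ι → ℝ} (hq : ∀ i, 0 ≤ q i)
    (E : κ → Set (Fin n → ι)) : sampleProb q (⋃ k, E k) ≤ ∑ k, sampleProb q (E k) := by
  simp only [sampleProb]
  rw [Finset.sum_comm]
  refine Finset.sum_le_sum fun ρ _ => ?_
  have h0 : ∀ k, 0 ≤ (E k).indicator (sampleWeight q) ρ := fun k =>
    Set.indicator_nonneg (fun ρ _ => sampleWeight_nonneg hq ρ) ρ
  by_cases h : ρ ∈ ⋃ k, E k
  · obtain ⟨k, hk⟩ := Set.mem_iUnion.1 h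
    rw [Set.indicator_of_mem h, ← Set.indicator_of_mem hk (sampleWeight q)]
    exact Finset.single_le_sum (f := fun k => (E k).indicator (sampleWeight q) ρ)
      (fun k _ => h0 k) (Finset.mem_univ k)
  · rw [Set.indicator_of_notMem h]
    exact Finset.sum_nonneg fun k _ => h0 k

theorem sampleProb_compl {q : ι → ℝ} (hq1 : ∑ i, q i = 1) (E : Set (Fin n → ι)) :
    sampleProb q Eᶜ = 1 - sampleProb q E := by
  rw [eq_sub_iff_add_eq, sampleProb, sampleProb, ← Finset.sum_add_distrib,
    ← sum_sampleWeight (n := n) hq1]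
  refine Finset.sum_congr rfl fun ρ _ => ?_
  by_cases h : ρ ∈ E <;> simp [h]

/-- Markov's inequality. -/
theorem mul_sampleProb_le {q : ι → ℝ} (hq : ∀ i, 0 ≤ q i) {E : Set (Fin n → ι)}
    {f : (Fin n → ι) → ℝ} (hf : ∀ ρ, 0 ≤ f ρ) {t : ℝ} (h : ∀ ρ ∈ E, t ≤ f ρ) :
    t * sampleProb q E ≤ ∑ ρ, sampleWeight q ρ * f ρ := by
  rw [sampleProb, Finset.mul_sum]
  refine Finset.sum_le_sum fun ρ _ => ?_
  have h0 := sampleWeight_nonneg hq ρ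
  by_cases hE : ρ ∈ E
  · rw [Set.indicator_of_mem hE, mul_comm]
    exact mul_le_mul_of_nonneg_left (h ρ hE) h0
  · rw [Set.indicator_of_notMem hE, mul_zero]
    exact mul_nonneg h0 (hf ρ)

/-- Markov's inequality in the form `P(f > R / c) ≤ c`, valid also when `R = 0`. -/
theorem sampleProb_lt_le {q : ι → ℝ} (hq : ∀ i, 0 ≤ q i) {f : (Fin n → ι) → ℝ}
    (hf : ∀ ρ, 0 ≤ f ρ) {R c : ℝ} (hc : 0 < c) (hR : 0 ≤ R)
    (h : ∑ ρ, sampleWeight q ρ * f ρ ≤ R) : sampleProb q {ρ | R / c < f ρ} ≤ c := by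
  rcases hR.eq_or_lt with rfl | hR
  · have h0 : ∀ ρ, 0 ≤ sampleWeight q ρ * f ρ :=
      fun ρ => mul_nonneg (sampleWeight_nonneg hq ρ) (hf ρ)
    have h1 := (Finset.sum_eq_zero_iff_of_nonneg fun ρ _ => h0 ρ).1
      (le_antisymm h (Finset.sum_nonneg fun ρ _ => h0 ρ))
    refine le_trans (le_of_eq (Finset.sum_eq_zero fun ρ hρ => ?_)) hc.le
    refine Set.indicator_apply_eq_zero.2 fun hmem => ?_
    rcases mul_eq_zero.1 (h1 ρ hρ) with h2 | h2
    · exact h2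
    · simp [h2] at hmem
  · have h1 := mul_sampleProb_le hq hf (E := {ρ | R / c < f ρ}) (t := R / c)
      (fun ρ hρ => le_of_lt hρ)
    have h2 : R / c * sampleProb q {ρ | R / c < f ρ} ≤ R / c * c := by
      rw [div_mul_cancel₀ _ hc.ne']; linarith
    exact le_of_mul_le_mul_left h2 (by positivity)

/-- Events determined by the sampled rows have the probability given by `sampleProb`. -/
theorem measureReal_eq_sampleProb {m : ℕ} {Ω : Type*} [MeasurableSpace Ω] {μ : Measure Ω}
    [IsProbabilityMeasure μ] {τ : Fin m → ℝ} {r : Fin n → Ω → Fin m} (hr : IsRowSample μ τ r)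
    (E : Set (Fin n → Fin m)) :
    μ.real {ω | (fun j => r j ω) ∈ E} = sampleProb (fun i => τ i / ∑ i', τ i') E := by
  classical
  have hpt : ∀ ρ : Fin n → Fin m, μ.real {ω | (fun j => r j ω) = ρ} =
      sampleWeight (fun i => τ i / ∑ i', τ i') ρ := by
    intro ρ
    have h1 : {ω | (fun j => r j ω) = ρ} = ⋂ j, r j ⁻¹' {ρ j} := by
      ext ω; simp [funext_iff]
    have h2 := hr.indep.meas_iInter (s := fun j => r j ⁻¹' {ρ j})
      (fun j => ⟨{ρ j}, measurableSet_singleton _, rfl⟩)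
    rw [h1, measureReal_def, h2, ENNReal.toReal_prod]
    exact Finset.prod_congr rfl fun j _ => hr.law j (ρ j)
  have hmeas : ∀ ρ : Fin n → Fin m, MeasurableSet {ω | (fun j => r j ω) = ρ} := fun ρ =>
    (measurable_pi_lambda _ hr.measurable) (measurableSet_singleton ρ)
  have h1 : {ω | (fun j => r j ω) ∈ E} =
      ⋃ ρ ∈ Finset.univ.filter (· ∈ E), {ω | (fun j => r j ω) = ρ} := by
    ext ω; simp
  rw [h1, measureReal_biUnion_finset (fun ρ _ σ _ hne => ?_) (fun ρ _ => hmeas ρ), sampleProb,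
    Finset.sum_filter]
  · refine Finset.sum_congr rfl fun ρ _ => ?_
    by_cases h : ρ ∈ E <;> simp [h, hpt]
  · refine Set.disjoint_left.2 fun ω h h' => hne ?_
    exact (h : _ = ρ).symm.trans h'

end SampleProb

/-! ### A matrix tail bound with intrinsic dimension -/

section MatrixTail

variable {ι p : Type*} [Fintype ι] [Fintype p] [DecidableEq p]

theorem trace_expExcess_eq (A : Matrix p p ℝ) :
    (expExcess A).trace = (NormedSpace.exp A).trace - A.trace - (1 : Matrix p p ℝ).trace := by
  simp [expExcess, Matrix.trace_sub]

/-- Adding one centred bounded random matrix with variance at most `κ K` increases the expected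
potential by at most a factor `1 + 2 κ` and an additive multiple of `tr K`. -/
theorem sum_trace_expExcess_add_le {q : ι → ℝ} (hq : ∀ i, 0 ≤ q i) (hq1 : ∑ i, q i = 1)
    {B : ι → Matrix p p ℝ} (hB : ∀ i, (B i)ᵀ = B i)
    (hB1 : ∀ i (x : p → ℝ), |x ⬝ᵥ B i *ᵥ x| ≤ x ⬝ᵥ x) (hB0 : ∑ i, q i • B i = 0)
    {K : Matrix p p ℝ} (hK : K.PosSemidef) (hK1 : (1 - K).PosSemidef) {κ : ℝ} (hκ : 0 ≤ κ)
    (hvar : (κ • K - ∑ i, q i • B i ^ 2).PosSemidef) {A : Matrix p p ℝ} (hA : Aᵀ = A) :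
    ∑ i, q i * (expExcess (B i + A)).trace ≤
      (expExcess A).trace + κ * (3 * K.trace + 2 * (expExcess A).trace) := by
  have hE := posSemidef_exp hA
  have hstep : ∀ i, (NormedSpace.exp (B i + A)).trace ≤
      (NormedSpace.exp A).trace + (NormedSpace.exp A * B i).trace +
        (NormedSpace.exp A * B i ^ 2).trace := by
    intro i
    have h1 := trace_exp_add_le hA (hB i)
    have h2 := trace_mul_le_trace_mul hE (posSemidef_one_add_add_sq_sub_exp (hB i) (hB1 i))
    rw [Matrix.mul_add, Matrix.mul_add, Matrix.mul_one, Matrix.trace_add, Matrix.trace_add] at h2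
    rw [add_comm (B i)]
    linarith
  have hlin : ∑ i, q i * (NormedSpace.exp A * B i).trace = 0 := by
    have : ∑ i, q i * (NormedSpace.exp A * B i).trace =
        (NormedSpace.exp A * ∑ i, q i • B i).trace := by
      simp [Matrix.mul_sum, Matrix.trace_sum]
    rw [this, hB0]; simp
  have hlin' : ∑ i, q i * (B i).trace = 0 := by
    have : ∑ i, q i * (B i).trace = (∑ i, q i • B i).trace := by simp [Matrix.trace_sum]
    rw [this, hB0]; simp
  have hquad : ∑ i, q i * (NormedSpace.exp A * B i ^ 2).trace ≤
      κ * (NormedSpace.exp A * K).trace := by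
    have h1 := trace_mul_le_trace_mul hE hvar
    simpa [Matrix.mul_sum, Matrix.trace_sum] using h1
  have hsum : ∑ i, q i * (expExcess (B i + A)).trace ≤
      (expExcess A).trace + κ * (NormedSpace.exp A * K).trace := by
    calc ∑ i, q i * (expExcess (B i + A)).trace
        ≤ ∑ i, q i * ((expExcess A).trace - (B i).trace + (NormedSpace.exp A * B i).trace +
          (NormedSpace.exp A * B i ^ 2).trace) := by
          refine Finset.sum_le_sum fun i _ => mul_le_mul_of_nonneg_left ?_ (hq i)
          rw [trace_expExcess_eq, trace_expExcess_eq, Matrix.trace_add]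
          linarith [hstep i]
      _ = (expExcess A).trace + ∑ i, q i * (NormedSpace.exp A * B i ^ 2).trace := by
          simp only [mul_add, mul_sub, Finset.sum_add_distrib, Finset.sum_sub_distrib,
            ← Finset.sum_mul, hq1, hlin, hlin']
          ring
      _ ≤ _ := by linarith
  -- `exp y ≤ 3 + 2 (exp y - y - 1)` turns the trace against `K` back into the potential
  have h3 : (NormedSpace.exp A * K).trace ≤ 3 * K.trace + 2 * (expExcess A * K).trace := by
    have h := posSemidef_quadratic_add_exp (isHermitian_of_transpose_eq hA) 1 (-2) 0 1 (fun i => by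
      set l := (isHermitian_of_transpose_eq hA).eigenvalues i
      have h1 := Real.add_one_le_exp l
      have h2 := Real.exp_pos l
      have h3 := Real.add_one_le_exp (l - 1)
      have h4 : Real.exp l = Real.exp 1 * Real.exp (l - 1) := by rw [← Real.exp_add]; ring_nf
      have h5 := Real.add_one_le_exp (1 : ℝ)
      nlinarith [Real.exp_pos (l - 1)])
    have h' := trace_mul_nonneg h hK
    simp only [expExcess, Matrix.sub_mul, Matrix.add_mul, Matrix.trace_add, Matrix.trace_sub,
      Matrix.smul_mul, Matrix.trace_smul, Matrix.one_mul, smul_eq_mul] at h' ⊢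
    linarith
  have h4 : (expExcess A * K).trace ≤ (expExcess A).trace := by
    simpa using trace_mul_le_trace_mul (posSemidef_expExcess hA) hK1
  nlinarith

/-- The expected potential of a sum of independent centred bounded matrices: the recursion of
`sum_trace_expExcess_add_le`, solved from the initial value `0`. -/
theorem sum_sampleWeight_trace_expExcess_le {q : ι → ℝ} (hq : ∀ i, 0 ≤ q i)
    (hq1 : ∑ i, q i = 1) {B : ι → Matrix p p ℝ} (hB : ∀ i, (B i)ᵀ = B i)
    (hB1 : ∀ i (x : p → ℝ), |x ⬝ᵥ B i *ᵥ x| ≤ x ⬝ᵥ x) (hB0 : ∑ i, q i • B i = 0)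
    {K : Matrix p p ℝ} (hK : K.PosSemidef) (hK1 : (1 - K).PosSemidef) {κ : ℝ} (hκ : 0 ≤ κ)
    (hvar : (κ • K - ∑ i, q i • B i ^ 2).PosSemidef) (n : ℕ) :
    ∑ ρ : Fin n → ι, sampleWeight q ρ * (expExcess (∑ j, B (ρ j))).trace ≤
      3 / 2 * K.trace * ((1 + 2 * κ) ^ n - 1) := by
  induction n with
  | zero => simp [expExcess]
  | succ n ih =>
    rw [sum_sampleWeight_cons]
    simp only [Fin.sum_univ_succ, Fin.cons_zero, Fin.cons_succ]
    have h1 : ∀ ρ : Fin n → ι, (∑ j, B (ρ j))ᵀ = ∑ j, B (ρ j) := by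
      intro ρ
      rw [Matrix.transpose_sum]
      exact Finset.sum_congr rfl fun j _ => hB _
    calc _ ≤ ∑ ρ : Fin n → ι, sampleWeight q ρ * ((expExcess (∑ j, B (ρ j))).trace +
          κ * (3 * K.trace + 2 * (expExcess (∑ j, B (ρ j))).trace)) := by
          refine Finset.sum_le_sum fun ρ _ =>
            mul_le_mul_of_nonneg_left ?_ (sampleWeight_nonneg hq ρ)
          exact sum_trace_expExcess_add_le hq hq1 hB hB1 hB0 hK hK1 hκ hvar (h1 ρ)
      _ = (1 + 2 * κ) * (∑ ρ : Fin n → ι,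
            sampleWeight q ρ * (expExcess (∑ j, B (ρ j))).trace) + 3 * κ * K.trace := by
          have h2 : 3 * κ * K.trace = ∑ ρ : Fin n → ι, 3 * κ * K.trace * sampleWeight q ρ := by
            rw [← Finset.mul_sum, sum_sampleWeight hq1, mul_one]
          rw [h2, Finset.mul_sum, ← Finset.sum_add_distrib]
          exact Finset.sum_congr rfl fun ρ _ => by ring
      _ ≤ (1 + 2 * κ) * (3 / 2 * K.trace * ((1 + 2 * κ) ^ n - 1)) + 3 * κ * K.trace := by
          gcongr
      _ = _ := by ring

/-- A tail bound for the largest eigenvalue of a sum of independent centred bounded symmetric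
random matrices, proportional to the trace of the variance proxy. -/
theorem mul_sampleProb_exists_lt_le {q : ι → ℝ} (hq : ∀ i, 0 ≤ q i)
    (hq1 : ∑ i, q i = 1) {B : ι → Matrix p p ℝ} (hB : ∀ i, (B i)ᵀ = B i)
    (hB1 : ∀ i (x : p → ℝ), |x ⬝ᵥ B i *ᵥ x| ≤ x ⬝ᵥ x) (hB0 : ∑ i, q i • B i = 0)
    {K : Matrix p p ℝ} (hK : K.PosSemidef) (hK1 : (1 - K).PosSemidef) {κ : ℝ} (hκ : 0 ≤ κ)
    (hvar : (κ • K - ∑ i, q i • B i ^ 2).PosSemidef) (n : ℕ) {t : ℝ} (ht : 0 ≤ t) :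
    (Real.exp t - t - 1) * sampleProb q {ρ : Fin n → ι |
        ∃ x : p → ℝ, t * (x ⬝ᵥ x) < x ⬝ᵥ (∑ j, B (ρ j)) *ᵥ x} ≤
      3 / 2 * K.trace * Real.exp (2 * κ * n) := by
  have h1 : ∀ ρ : Fin n → ι, (∑ j, B (ρ j))ᵀ = ∑ j, B (ρ j) := by
    intro ρ
    rw [Matrix.transpose_sum]
    exact Finset.sum_congr rfl fun j _ => hB _
  refine (mul_sampleProb_le hq (f := fun ρ => (expExcess (∑ j, B (ρ j))).trace)
    (fun ρ => (posSemidef_expExcess (h1 ρ)).trace_nonneg) ?_).trans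
    ((sum_sampleWeight_trace_expExcess_le hq hq1 hB hB1 hB0 hK hK1 hκ hvar n).trans ?_)
  · rintro ρ ⟨x, hx⟩
    exact le_trace_expExcess (h1 ρ) ht hx
  · have h2 : (1 + 2 * κ) ^ n ≤ Real.exp (2 * κ * n) := by
      rw [mul_comm (2 * κ) (n : ℝ), Real.exp_nat_mul]
      gcongr
      linarith [Real.add_one_le_exp (2 * κ)]
    have h3 := hK.trace_nonneg
    gcongr
    linarith

end MatrixTail

/-! ### Row sampling of a contraction -/

section RowSampling

variable {ι p : Type*}

section

variable [Fintype ι]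

theorem gram_eq_sum_vecMulVec (V : Matrix ι p ℝ) : Vᵀ * V = ∑ i, vecMulVec (V i) (V i) := by
  ext a b
  simp [Matrix.mul_apply, Matrix.sum_apply, Matrix.vecMulVec_apply]

/-- The contribution of one draw of row `i` of `V` to the deviation of the Gram matrix `VᵀV` from
its sampled version, up to normalization. The factor `1 / 16` makes its variance small compared
with the deviation that has to be excluded. -/
def rowDeviation (V : Matrix ι p ℝ) (τ : ι → ℝ) (i : ι) : Matrix p p ℝ :=
  (1 / 16 : ℝ) • ((∑ i, τ i)⁻¹ • (Vᵀ * V) - (τ i)⁻¹ • vecMulVec (V i) (V i))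

theorem rowDeviation_transpose (V : Matrix ι p ℝ) (τ : ι → ℝ) (i : ι) :
    (rowDeviation V τ i)ᵀ = rowDeviation V τ i := by
  simp [rowDeviation, Matrix.transpose_vecMulVec]

end

variable [Fintype p]

theorem dotProduct_sq_le (x y : p → ℝ) : (x ⬝ᵥ y) ^ 2 ≤ (x ⬝ᵥ x) * (y ⬝ᵥ y) := by
  have h := Finset.sum_mul_sq_le_sq_mul_sq Finset.univ x y
  simpa only [dotProduct, ← pow_two] using h

theorem zero_le_dotProduct_self (x : p → ℝ) : 0 ≤ x ⬝ᵥ x :=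
  Finset.sum_nonneg fun _ _ => mul_self_nonneg _

section

variable {V : Matrix ι p ℝ} {τ : ι → ℝ}

theorem inv_mul_dotProduct_sq_le (hτ : ∀ i, 0 ≤ τ i) (hrow : ∀ i, V i ⬝ᵥ V i ≤ τ i) (i : ι)
    (x : p → ℝ) : (τ i)⁻¹ * (V i ⬝ᵥ x) ^ 2 ≤ x ⬝ᵥ x := by
  have hx := zero_le_dotProduct_self x
  rcases (hτ i).eq_or_lt with h | h
  · simpa [← h] using hx
  · rw [inv_mul_le_iff₀ h]
    exact (dotProduct_sq_le _ _).trans (mul_le_mul_of_nonneg_right (hrow i) hx)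

theorem mul_inv_smul_row (hrow : ∀ i, V i ⬝ᵥ V i ≤ τ i) (i : ι) :
    (τ i * (τ i)⁻¹) • V i = V i := by
  rcases eq_or_ne (τ i) 0 with h | h
  · have h0 : V i ⬝ᵥ V i = 0 := le_antisymm (h ▸ hrow i) (zero_le_dotProduct_self _)
    rw [dotProduct_self_eq_zero.1 h0, smul_zero]
  · rw [mul_inv_cancel₀ h, one_smul]

end

variable [Fintype ι]

theorem dotProduct_gram_mulVec (V : Matrix ι p ℝ) (x : p → ℝ) :
    x ⬝ᵥ (Vᵀ * V) *ᵥ x = ∑ i, (V i ⬝ᵥ x) ^ 2 := by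
  rw [← Matrix.mulVec_mulVec, Matrix.dotProduct_mulVec, Matrix.vecMul_transpose]
  simp [dotProduct, Matrix.mulVec, pow_two]

theorem rowDeviation_mulVec (V : Matrix ι p ℝ) (τ : ι → ℝ) (i : ι) (x : p → ℝ) :
    rowDeviation V τ i *ᵥ x =
      (1 / 16 : ℝ) • ((∑ i, τ i)⁻¹ • (Vᵀ * V) *ᵥ x - ((τ i)⁻¹ * (V i ⬝ᵥ x)) • V i) := by
  simp only [rowDeviation, Matrix.smul_mulVec, Matrix.sub_mulVec, Matrix.vecMulVec_mulVec]
  simp [smul_smul]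

theorem dotProduct_rowDeviation_mulVec (V : Matrix ι p ℝ) (τ : ι → ℝ) (i : ι) (x : p → ℝ) :
    x ⬝ᵥ rowDeviation V τ i *ᵥ x =
      1 / 16 * ((∑ i, τ i)⁻¹ * ∑ i, (V i ⬝ᵥ x) ^ 2 - (τ i)⁻¹ * (V i ⬝ᵥ x) ^ 2) := by
  rw [rowDeviation_mulVec, dotProduct_smul, dotProduct_sub, dotProduct_smul, dotProduct_smul,
    dotProduct_gram_mulVec, dotProduct_comm x (V i)]
  simp only [smul_eq_mul]
  ring

variable {V : Matrix ι p ℝ} {τ : ι → ℝ}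

theorem sum_smul_rowDeviation (hs : 0 < ∑ i, τ i) (hrow : ∀ i, V i ⬝ᵥ V i ≤ τ i) :
    ∑ i, (τ i / ∑ i', τ i') • rowDeviation V τ i = 0 := by
  set s := ∑ i, τ i with hs'
  have h1 : ∀ i, (τ i / s) • rowDeviation V τ i =
      (1 / 16 * s⁻¹ * s⁻¹ * τ i) • (Vᵀ * V) - (1 / 16 * s⁻¹) • vecMulVec (V i) (V i) := by
    intro i
    have h2 : (τ i * (τ i)⁻¹) • vecMulVec (V i) (V i) = vecMulVec (V i) (V i) := by
      rw [← Matrix.smul_vecMulVec, mul_inv_smul_row hrow]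
    rw [rowDeviation, ← hs']
    conv_rhs => rw [← h2]
    module
  simp only [h1, Finset.sum_sub_distrib, ← Finset.sum_smul, ← Finset.smul_sum, ← Finset.mul_sum,
    ← gram_eq_sum_vecMulVec]
  rw [← hs', mul_assoc, inv_mul_cancel₀ hs.ne', mul_one, sub_self]

theorem sum_mul_rowDeviation_sq_le (hτ : ∀ i, 0 ≤ τ i) (hs : 0 < ∑ i, τ i)
    (hrow : ∀ i, V i ⬝ᵥ V i ≤ τ i) [DecidableEq p] :
    ((1 / (256 * ∑ i, τ i)) • (Vᵀ * V) -
      ∑ i, (τ i / ∑ i', τ i') • rowDeviation V τ i ^ 2).PosSemidef := by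
  set s := ∑ i, τ i with hs'
  refine Matrix.PosSemidef.of_dotProduct_mulVec_nonneg (isHermitian_of_transpose_eq ?_)
    fun x => ?_
  · simp [Matrix.transpose_sum, Matrix.transpose_pow, rowDeviation_transpose]
  have hq : ∑ i, τ i / s = 1 := by rw [← Finset.sum_div, div_self hs.ne']
  have hsq : ∀ i, x ⬝ᵥ (rowDeviation V τ i ^ 2) *ᵥ x =
      1 / 256 * (s⁻¹ ^ 2 * ((Vᵀ * V) *ᵥ x ⬝ᵥ (Vᵀ * V) *ᵥ x) -
        2 * s⁻¹ * ((τ i)⁻¹ * (V i ⬝ᵥ x) * (V i ⬝ᵥ (Vᵀ * V) *ᵥ x)) +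
        ((τ i)⁻¹ * (V i ⬝ᵥ x)) ^ 2 * (V i ⬝ᵥ V i)) := by
    intro i
    rw [pow_two, ← Matrix.mulVec_mulVec, Matrix.dotProduct_mulVec, ← Matrix.mulVec_transpose,
      rowDeviation_transpose, rowDeviation_mulVec, ← hs']
    simp only [dotProduct_smul, smul_dotProduct, dotProduct_sub, sub_dotProduct, smul_eq_mul]
    rw [dotProduct_comm _ (V i)]
    ring
  set y := (Vᵀ * V) *ᵥ x with hy
  have hcross : ∑ i, (V i ⬝ᵥ x) * (V i ⬝ᵥ y) = y ⬝ᵥ y := by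
    have hysum : y = ∑ i, (V i ⬝ᵥ x) • V i := by
      rw [hy, gram_eq_sum_vecMulVec, Matrix.sum_mulVec]
      refine Finset.sum_congr rfl fun i _ => ?_
      rw [Matrix.vecMulVec_mulVec]
      simp
    calc ∑ i, (V i ⬝ᵥ x) * (V i ⬝ᵥ y) = (∑ i, (V i ⬝ᵥ x) • V i) ⬝ᵥ y := by
          simp [sum_dotProduct]
      _ = y ⬝ᵥ y := by rw [← hysum]
  have hcancel : ∀ i, τ i * (τ i)⁻¹ * (V i ⬝ᵥ x) = V i ⬝ᵥ x := fun i => by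
    conv_rhs => rw [← mul_inv_smul_row hrow i, smul_dotProduct, smul_eq_mul]
  have hterm : ∀ i, (τ i / s) * (x ⬝ᵥ (rowDeviation V τ i ^ 2) *ᵥ x) ≤
      1 / 256 * (s⁻¹ ^ 2 * (y ⬝ᵥ y) * (τ i / s) -
        2 * s⁻¹ ^ 2 * ((V i ⬝ᵥ x) * (V i ⬝ᵥ y)) + s⁻¹ * (V i ⬝ᵥ x) ^ 2) := by
    intro i
    have h1 : (τ i)⁻¹ * (V i ⬝ᵥ V i) ≤ 1 := by
      rcases (hτ i).eq_or_lt with h | h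
      · simp [← h]
      · rw [inv_mul_le_iff₀ h, mul_one]; exact hrow i
    have h2 : s⁻¹ * (V i ⬝ᵥ x) ^ 2 * ((τ i)⁻¹ * (V i ⬝ᵥ V i)) ≤ s⁻¹ * (V i ⬝ᵥ x) ^ 2 :=
      mul_le_of_le_one_right (by positivity) h1
    rw [hsq]
    have h3 : τ i / s * (1 / 256 * (s⁻¹ ^ 2 * (y ⬝ᵥ y) -
        2 * s⁻¹ * ((τ i)⁻¹ * (V i ⬝ᵥ x) * (V i ⬝ᵥ y)) +
        ((τ i)⁻¹ * (V i ⬝ᵥ x)) ^ 2 * (V i ⬝ᵥ V i))) =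
        1 / 256 * (s⁻¹ ^ 2 * (y ⬝ᵥ y) * (τ i / s) -
        2 * s⁻¹ ^ 2 * ((τ i * (τ i)⁻¹ * (V i ⬝ᵥ x)) * (V i ⬝ᵥ y)) +
        s⁻¹ * (τ i * (τ i)⁻¹ * (V i ⬝ᵥ x)) * (V i ⬝ᵥ x) * ((τ i)⁻¹ * (V i ⬝ᵥ V i))) := by
      ring
    rw [h3, hcancel]
    nlinarith
  have hsum := Finset.sum_le_sum fun i (_ : i ∈ Finset.univ) => hterm i
  rw [← Finset.mul_sum, Finset.sum_add_distrib, Finset.sum_sub_distrib, ← Finset.mul_sum,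
    ← Finset.mul_sum, ← Finset.mul_sum, hq, hcross] at hsum
  rw [star_trivial, Matrix.sub_mulVec, dotProduct_sub, Matrix.smul_mulVec, dotProduct_smul,
    dotProduct_gram_mulVec, Matrix.sum_mulVec, dotProduct_sum]
  simp only [Matrix.smul_mulVec, dotProduct_smul, smul_eq_mul]
  have h4 : 1 / (256 * s) * ∑ i, (V i ⬝ᵥ x) ^ 2 = 1 / 256 * (s⁻¹ * ∑ i, (V i ⬝ᵥ x) ^ 2) := by
    field_simp
  have h5 : 0 ≤ s⁻¹ ^ 2 * (y ⬝ᵥ y) := mul_nonneg (by positivity) (zero_le_dotProduct_self y)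
  rw [h4]
  linarith

/-- If the rows of a contraction `V` are sampled with weights `τ i ≥ |V i|²`, then the sampled
Gram matrix dominates `VᵀV - 1/4`, except with probability `3 s exp (-n / (128 s))` where
`s = ∑ τ i`. -/
theorem sampleProb_gram_deviation_le [DecidableEq p] (hτ : ∀ i, 0 ≤ τ i) (hs : 0 < ∑ i, τ i)
    (hrow : ∀ i, V i ⬝ᵥ V i ≤ τ i) (hV : ∀ x : p → ℝ, ∑ i, (V i ⬝ᵥ x) ^ 2 ≤ x ⬝ᵥ x)
    {n : ℕ} (hn : 192 * ∑ i, τ i ≤ n) :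
    sampleProb (fun i => τ i / ∑ i', τ i') {ρ : Fin n → ι | ∃ x : p → ℝ,
      1 / 4 * (x ⬝ᵥ x) < ∑ i, (V i ⬝ᵥ x) ^ 2 -
        ∑ j, (∑ i, τ i) / (n * τ (ρ j)) * (V (ρ j) ⬝ᵥ x) ^ 2} ≤
      3 * (∑ i, τ i) * Real.exp (-(n / (128 * ∑ i, τ i))) := by
  set s := ∑ i, τ i with hs'
  have hn0 : (0 : ℝ) < n := by linarith
  have hq : ∀ i, 0 ≤ τ i / s := fun i => div_nonneg (hτ i) hs.le
  have hq1 : ∑ i, τ i / s = 1 := by rw [← Finset.sum_div, div_self hs.ne']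
  have hKs : ∀ x : p → ℝ, ∑ i, (V i ⬝ᵥ x) ^ 2 ≤ s * (x ⬝ᵥ x) := fun x => by
    rw [hs', Finset.sum_mul]
    exact Finset.sum_le_sum fun i _ => (dotProduct_sq_le _ _).trans
      (mul_le_mul_of_nonneg_right (hrow i) (zero_le_dotProduct_self x))
  have hK : (Vᵀ * V).PosSemidef := by
    simpa using Matrix.posSemidef_conjTranspose_mul_self V
  have hK1 : (1 - Vᵀ * V).PosSemidef := by
    refine Matrix.PosSemidef.of_dotProduct_mulVec_nonneg (isHermitian_of_transpose_eq (by simp))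
      fun x => ?_
    rw [star_trivial, Matrix.sub_mulVec, Matrix.one_mulVec, dotProduct_sub,
      dotProduct_gram_mulVec]
    linarith [hV x]
  have htr : (Vᵀ * V).trace ≤ s := by
    rw [gram_eq_sum_vecMulVec, Matrix.trace_sum]
    exact Finset.sum_le_sum fun i _ => by rw [Matrix.trace_vecMulVec]; exact hrow i
  have hB1 : ∀ i (x : p → ℝ), |x ⬝ᵥ rowDeviation V τ i *ᵥ x| ≤ x ⬝ᵥ x := by
    intro i x
    rw [dotProduct_rowDeviation_mulVec, ← hs']
    have h1 := inv_mul_dotProduct_sq_le hτ hrow i x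
    have h2 : s⁻¹ * ∑ i, (V i ⬝ᵥ x) ^ 2 ≤ x ⬝ᵥ x := by
      rw [inv_mul_le_iff₀ hs]; exact hKs x
    have h3 : 0 ≤ s⁻¹ * ∑ i, (V i ⬝ᵥ x) ^ 2 := by positivity
    have h4 : 0 ≤ (τ i)⁻¹ * (V i ⬝ᵥ x) ^ 2 := mul_nonneg (inv_nonneg.2 (hτ i)) (sq_nonneg _)
    rw [abs_le]
    constructor <;> linarith
  -- `t` is the deviation `1 / 4` in the normalization `n / (16 s)` of `∑ j, rowDeviation V τ (ρ j)`
  set t : ℝ := n / (64 * s) with ht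
  have ht3 : 3 ≤ t := by rw [ht, le_div_iff₀ (by positivity)]; linarith
  have htail := mul_sampleProb_exists_lt_le hq hq1 (rowDeviation_transpose V τ) hB1
    (sum_smul_rowDeviation hs hrow) hK hK1 (κ := 1 / (256 * s)) (by positivity)
    (sum_mul_rowDeviation_sq_le hτ hs hrow) n (t := t) (by linarith)
  set P := sampleProb (fun i => τ i / s) {ρ : Fin n → ι | ∃ x : p → ℝ,
    t * (x ⬝ᵥ x) < x ⬝ᵥ (∑ j, rowDeviation V τ (ρ j)) *ᵥ x} with hP
  have hmono : sampleProb (fun i => τ i / s) {ρ : Fin n → ι | ∃ x : p → ℝ,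
      1 / 4 * (x ⬝ᵥ x) < ∑ i, (V i ⬝ᵥ x) ^ 2 -
        ∑ j, s / (n * τ (ρ j)) * (V (ρ j) ⬝ᵥ x) ^ 2} ≤ P := by
    refine sampleProb_mono hq ?_
    rintro ρ ⟨x, hx⟩
    refine ⟨x, ?_⟩
    have h1 : x ⬝ᵥ (∑ j, rowDeviation V τ (ρ j)) *ᵥ x =
        n / (16 * s) * (∑ i, (V i ⬝ᵥ x) ^ 2 -
          ∑ j, s / (n * τ (ρ j)) * (V (ρ j) ⬝ᵥ x) ^ 2) := by
      rw [Matrix.sum_mulVec, dotProduct_sum]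
      simp only [dotProduct_rowDeviation_mulVec]
      rw [← Finset.mul_sum, Finset.sum_sub_distrib, mul_sub, mul_sub, Finset.mul_sum Finset.univ
        (fun j => s / (n * τ (ρ j)) * (V (ρ j) ⬝ᵥ x) ^ 2)]
      congr 1
      · simp only [Finset.sum_const, Finset.card_univ, Fintype.card_fin, nsmul_eq_mul, ← hs']
        field_simp
      · rw [Finset.mul_sum]
        refine Finset.sum_congr rfl fun j _ => ?_
        rw [div_eq_mul_inv s, mul_inv]
        field_simp
    rw [h1, ht]
    calc n / (64 * s) * (x ⬝ᵥ x) = n / (16 * s) * (1 / 4 * (x ⬝ᵥ x)) := by field_simp; ring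
      _ < _ := mul_lt_mul_of_pos_left hx (by positivity)
  have hP0 : 0 ≤ P := Finset.sum_nonneg fun ρ _ =>
    Set.indicator_nonneg (fun ρ _ => sampleWeight_nonneg hq ρ) ρ
  refine hmono.trans ?_
  have hexp : Real.exp t / 2 ≤ Real.exp t - t - 1 := by
    have h1 := Real.quadratic_le_exp_of_nonneg (x := t) (by linarith)
    nlinarith
  have h2 : 2 * (1 / (256 * s)) * n = t / 2 := by rw [ht]; field_simp; ring
  have h3 : n / (128 * s) = t / 2 := by rw [ht]; field_simp; ring
  rw [h2] at htail
  rw [h3]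
  have h4 : Real.exp t = Real.exp (t / 2) * Real.exp (t / 2) := by rw [← Real.exp_add]; ring_nf
  have h5 : Real.exp (t / 2) * (Real.exp (t / 2) * P) ≤ Real.exp (t / 2) * (3 * s) := by
    have h6 := mul_le_mul_of_nonneg_right hexp hP0
    have h7 := mul_le_mul_of_nonneg_right htr (Real.exp_pos (t / 2)).le
    rw [h4] at h6
    rw [h4] at htail
    linarith
  have h6 := le_of_mul_le_mul_left h5 (Real.exp_pos _)
  rw [Real.exp_neg, ← div_eq_mul_inv, le_div_iff₀ (Real.exp_pos _)]
  linarith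

end RowSampling

/-! ### Subspace embedding from ridge leverage scores -/

section Embedding

variable {ι p : Type*} [Fintype ι] [Fintype p]

theorem sqNorm_eq_dotProduct (v : ι → ℝ) : sqNorm v = v ⬝ᵥ v := by
  simp [sqNorm_eq_sum, dotProduct, pow_two]

theorem sqNorm_nonneg (v : ι → ℝ) : 0 ≤ sqNorm v := sq_nonneg _

theorem ridgeLeverage_nonneg {ε : ℝ} (hε : 0 ≤ ε) (M : Matrix ι p ℝ) (i : ι) :
    0 ≤ ridgeLeverage ε M i :=
  Real.iSup_nonneg fun _ => div_nonneg (sq_nonneg _)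
    (add_nonneg (sqNorm_nonneg _) (mul_nonneg hε (sqNorm_nonneg _)))

/-- A whitening of the ridge quadratic form `‖M α‖² + ε ‖α‖²`: a change of variables `α = W x` in
which the form is at most `|x|²`, and which loses nothing, since every `α` is matched by some `x`
with the same image under `M` and with `|x|²` equal to the form at `α`. The form may be singular
(when `ε = 0`), so `W` is built from the pseudo-inverse square root of `MᵀM + ε`. -/
theorem exists_whitening [DecidableEq p] {ε : ℝ} (hε : 0 ≤ ε) (M : Matrix ι p ℝ) :
    ∃ W : Matrix p p ℝ,
      (∀ x, sqNorm (M *ᵥ (W *ᵥ x)) + ε * sqNorm (W *ᵥ x) ≤ x ⬝ᵥ x) ∧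
      ∀ α, ∃ x, x ⬝ᵥ x = sqNorm (M *ᵥ α) + ε * sqNorm α ∧ M *ᵥ (W *ᵥ x) = M *ᵥ α := by
  set H : Matrix p p ℝ := Mᵀ * M + ε • (1 : Matrix p p ℝ) with hH
  have hform : ∀ α, α ⬝ᵥ H *ᵥ α = sqNorm (M *ᵥ α) + ε * sqNorm α := by
    intro α
    rw [hH, Matrix.add_mulVec, dotProduct_add, dotProduct_gram_mulVec, Matrix.smul_mulVec,
      Matrix.one_mulVec, dotProduct_smul, sqNorm_eq_dotProduct, sqNorm_eq_dotProduct, smul_eq_mul]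
    simp [dotProduct, Matrix.mulVec, pow_two]
  have hHt : Hᵀ = H := by simp [hH]
  have hPSD : H.PosSemidef := by
    refine Matrix.PosSemidef.of_dotProduct_mulVec_nonneg (isHermitian_of_transpose_eq hHt)
      fun α => ?_
    rw [star_trivial, hform]
    exact add_nonneg (sqNorm_nonneg _) (mul_nonneg hε (sqNorm_nonneg _))
  have hA := hPSD.isHermitian
  set l := hA.eigenvalues with hl
  have hl0 : ∀ i, 0 ≤ l i := hPSD.eigenvalues_nonneg
  set U : Matrix p p ℝ := (hA.eigenvectorUnitary).1 with hU
  have hUU : U * Uᵀ = 1 := by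
    rw [← Matrix.conjTranspose_eq_transpose_of_trivial]
    exact Unitary.coe_mul_star_self hA.eigenvectorUnitary
  have hUU' : Uᵀ * U = 1 := by
    rw [← Matrix.conjTranspose_eq_transpose_of_trivial]
    exact Unitary.coe_star_mul_self hA.eigenvectorUnitary
  have hspec : H = U * diagonal l * Uᵀ := by
    have h := hA.spectral_theorem
    rw [Unitary.conjStarAlgAut_apply] at h
    rw [← Matrix.conjTranspose_eq_transpose_of_trivial]
    exact h
  have hquad : ∀ y, (U *ᵥ y) ⬝ᵥ H *ᵥ (U *ᵥ y) = ∑ i, l i * y i ^ 2 := by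
    intro y
    rw [hspec, ← Matrix.mulVec_mulVec, ← Matrix.mulVec_mulVec, Matrix.mulVec_mulVec _ Uᵀ, hUU',
      Matrix.one_mulVec, Matrix.dotProduct_mulVec, ← Matrix.mulVec_transpose,
      Matrix.mulVec_mulVec, hUU', Matrix.one_mulVec]
    simp only [dotProduct, Matrix.mulVec_diagonal]
    exact Finset.sum_congr rfl fun i _ => by ring
  refine ⟨U * diagonal fun i => (√(l i))⁻¹, fun x => ?_, fun α => ?_⟩
  · rw [← hform, ← Matrix.mulVec_mulVec, hquad]
    refine Finset.sum_le_sum fun i _ => ?_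
    rw [Matrix.mulVec_diagonal, mul_pow, ← mul_assoc, inv_pow, Real.sq_sqrt (hl0 i), ← pow_two]
    exact mul_le_of_le_one_left (sq_nonneg _) mul_inv_le_one
  · set y := Uᵀ *ᵥ α with hy
    have hα : U *ᵥ y = α := by rw [hy, Matrix.mulVec_mulVec, hUU, Matrix.one_mulVec]
    refine ⟨fun i => √(l i) * y i, ?_, ?_⟩
    · rw [← hform]
      conv_rhs => rw [← hα]
      rw [hquad]
      refine Finset.sum_congr rfl fun i _ => ?_
      calc √(l i) * y i * (√(l i) * y i) = √(l i) ^ 2 * y i ^ 2 := by ring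
        _ = l i * y i ^ 2 := by rw [Real.sq_sqrt (hl0 i)]
    · -- the difference of the two vectors lies in the kernel of the form, hence in that of `M`
      set z := (U * diagonal fun i => (√(l i))⁻¹) *ᵥ (fun i => √(l i) * y i) with hz
      have hdiff : z - α = U *ᵥ (fun i => (√(l i))⁻¹ * (√(l i) * y i) - y i) := by
        conv_lhs => rw [← hα]
        rw [hz, ← Matrix.mulVec_mulVec, ← Matrix.mulVec_sub]
        congr 1
        ext i
        simp [Matrix.mulVec_diagonal]
      have h0 : sqNorm (M *ᵥ (z - α)) + ε * sqNorm (z - α) = 0 := by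
        rw [← hform, hdiff, hquad]
        refine Finset.sum_eq_zero fun i _ => ?_
        rcases (hl0 i).eq_or_lt with h | h
        · rw [← h]; simp
        · have hs : √(l i) ≠ 0 := (Real.sqrt_pos.2 h).ne'
          rw [inv_mul_cancel_left₀ hs, sub_self]; simp
      have h1 : sqNorm (M *ᵥ (z - α)) = 0 := by
        have := mul_nonneg hε (sqNorm_nonneg (z - α))
        linarith [sqNorm_nonneg (M *ᵥ (z - α))]
      rw [sqNorm_eq_dotProduct, dotProduct_self_eq_zero, Matrix.mulVec_sub] at h1
      exact sub_eq_zero.1 h1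

/-- The rows of the whitened matrix are bounded by the ridge leverage scores. -/
theorem dotProduct_whitened_row_le {ε : ℝ} (hε : 0 ≤ ε) {M : Matrix ι p ℝ} {W : Matrix p p ℝ}
    (hW : ∀ x, sqNorm (M *ᵥ (W *ᵥ x)) + ε * sqNorm (W *ᵥ x) ≤ x ⬝ᵥ x) (i : ι) :
    (M * W) i ⬝ᵥ (M * W) i ≤ ridgeLeverage ε M i := by
  set v := (M * W) i with hv
  rcases (zero_le_dotProduct_self v).eq_or_lt with h | h
  · rw [← h]; exact ridgeLeverage_nonneg hε M i
  -- the leverage score is tested at `α = W v`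
  have h1 : (M *ᵥ (W *ᵥ v)) i = v ⬝ᵥ v := by rw [Matrix.mulVec_mulVec]; rfl
  have h2 : W *ᵥ v ≠ 0 := by
    intro h0
    rw [h0, Matrix.mulVec_zero, Pi.zero_apply] at h1
    exact h.ne h1
  have h3 := le_ciSup (ridgeLeverage_bddAbove hε M i) ⟨W *ᵥ v, h2⟩
  refine le_trans ?_ h3
  simp only [h1, sq_abs]
  have h4 : (v ⬝ᵥ v) ^ 2 ≤ sqNorm (M *ᵥ (W *ᵥ v)) := by
    rw [sqNorm_eq_sum, ← h1]
    exact Finset.single_le_sum (f := fun i => (M *ᵥ (W *ᵥ v)) i ^ 2)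
      (fun j _ => sq_nonneg _) (Finset.mem_univ i)
  have h5 := mul_nonneg hε (sqNorm_nonneg (W *ᵥ v))
  have h6 : 0 < (v ⬝ᵥ v) ^ 2 := by positivity
  rw [le_div_iff₀ (by linarith), pow_two]
  exact mul_le_mul_of_nonneg_left (hW v) h.le

theorem sqNorm_sampleMatrix_mulVec {m n : ℕ} {τ : Fin m → ℝ} (hτ : ∀ i, 0 ≤ τ i)
    (ρ : Fin n → Fin m) (v : Fin m → ℝ) :
    sqNorm (sampleMatrix τ ρ *ᵥ v) = ∑ j, (∑ i, τ i) / (n * τ (ρ j)) * v (ρ j) ^ 2 := by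
  rw [sqNorm_eq_sum]
  refine Finset.sum_congr rfl fun j _ => ?_
  have h : (sampleMatrix τ ρ *ᵥ v) j = √((∑ i, τ i) / (n * τ (ρ j))) * v (ρ j) := by
    simp [sampleMatrix, Matrix.mulVec, dotProduct]
  rw [h, mul_pow, Real.sq_sqrt]
  exact div_nonneg (Finset.sum_nonneg fun i _ => hτ i) (mul_nonneg n.cast_nonneg (hτ _))

/-- Sampling with weights that dominate the ridge leverage scores preserves the ridge quadratic
form from below up to the factor `3 / 4`. -/
theorem sampleProb_not_embedding_le [DecidableEq p] {m n : ℕ} {ε : ℝ} (hε : 0 ≤ ε)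
    (M : Matrix (Fin m) p ℝ) {τ : Fin m → ℝ} (hM : ∀ i, ridgeLeverage ε M i ≤ τ i)
    (hs : 0 < ∑ i, τ i) (hn : 192 * ∑ i, τ i ≤ n) :
    sampleProb (fun i => τ i / ∑ i', τ i') {ρ : Fin n → Fin m | ∃ α : p → ℝ,
      sqNorm (sampleMatrix τ ρ *ᵥ (M *ᵥ α)) + ε * sqNorm α <
        3 / 4 * (sqNorm (M *ᵥ α) + ε * sqNorm α)} ≤
      3 * (∑ i, τ i) * Real.exp (-(n / (128 * ∑ i, τ i))) := by
  have hτ : ∀ i, 0 ≤ τ i := fun i => (ridgeLeverage_nonneg hε M i).trans (hM i)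
  obtain ⟨W, hW, hW'⟩ := exists_whitening hε M
  have hval : ∀ x i, (M * W) i ⬝ᵥ x = (M *ᵥ (W *ᵥ x)) i := fun x i => by
    rw [Matrix.mulVec_mulVec]; rfl
  have hnorm : ∀ x, ∑ i, ((M * W) i ⬝ᵥ x) ^ 2 = sqNorm (M *ᵥ (W *ᵥ x)) := fun x => by
    simp only [hval, sqNorm_eq_sum]
  refine (sampleProb_mono (fun i => div_nonneg (hτ i) hs.le) ?_).trans
    (sampleProb_gram_deviation_le (V := M * W) hτ hs
      (fun i => (dotProduct_whitened_row_le hε hW i).trans (hM i)) (fun x => ?_) hn)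
  · rintro ρ ⟨α, hα⟩
    obtain ⟨x, hx, hx'⟩ := hW' α
    refine ⟨x, ?_⟩
    rw [hnorm, hx, hx']
    simp only [hval, hx']
    rw [sqNorm_sampleMatrix_mulVec hτ] at hα
    linarith
  · rw [hnorm]
    have := mul_nonneg hε (sqNorm_nonneg (W *ᵥ x))
    linarith [hW x]

end Embedding

/-! ### Ridge regression over several designs -/

section Regression

variable {ι κ : Type*} [Fintype ι] [Fintype κ]

theorem exists_forall_ridgeCost_le {ε : ℝ} (hε : 0 ≤ ε) (A : Matrix ι κ ℝ) (b : ι → ℝ) :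
    ∃ x, ∀ x', ridgeCost ε A b x ≤ ridgeCost ε A b x' := by
  classical
  -- ridge regression is least squares for the design `A` stacked on `√ε`
  set T : (κ → ℝ) →ₗ[ℝ] EuclideanSpace ℝ (ι ⊕ κ) :=
    (WithLp.linearEquiv 2 ℝ (ι ⊕ κ → ℝ)).symm.toLinearMap ∘ₗ
      (Matrix.fromRows A (√ε • (1 : Matrix κ κ ℝ))).mulVecLin with hT
  have hcost : ∀ x, ridgeCost ε A b x = dist (WithLp.toLp 2 (Sum.elim b 0)) (T x) ^ 2 := by
    intro x
    rw [dist_comm, EuclideanSpace.dist_eq, Real.sq_sqrt (Finset.sum_nonneg fun _ _ => sq_nonneg _)]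
    simp [ridgeCost, sqNorm_eq_sum, hT, Matrix.fromRows_mulVec, Matrix.smul_mulVec, mul_pow,
      Real.dist_eq, Real.sq_sqrt hε, Finset.mul_sum]
  have hclosed : IsClosed (LinearMap.range T : Set (EuclideanSpace ℝ (ι ⊕ κ))) :=
    Submodule.closed_of_finiteDimensional _
  obtain ⟨_, ⟨x, rfl⟩, hx⟩ := hclosed.exists_infDist_eq_dist ⟨0, Submodule.zero_mem _⟩
    (WithLp.toLp 2 (Sum.elim b 0))
  refine ⟨x, fun x' => ?_⟩
  rw [hcost, hcost, ← hx]
  exact pow_le_pow_left₀ Metric.infDist_nonneg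
    (Metric.infDist_le_dist_of_mem (LinearMap.mem_range_self T x')) 2

theorem exists_isRidgeArgmin {Q : ℕ} (hQ : 0 < Q) {ε : ℝ} (hε : 0 ≤ ε)
    (A : Fin Q → Matrix ι κ ℝ) (b : ι → ℝ) : ∃ k x, IsRidgeArgmin ε A b k x := by
  have : Nonempty (Fin Q) := ⟨⟨0, hQ⟩⟩
  choose x hx using fun k => exists_forall_ridgeCost_le hε (A k) b
  obtain ⟨k, hk⟩ := Finite.exists_min fun k => ridgeCost ε (A k) b (x k)
  exact ⟨k, x k, fun k' x' => (hk k').trans (hx k' x')⟩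

theorem IsRidgeArgmin.ridgeCost_le_iInf {Q : ℕ} {ε : ℝ} {A : Fin Q → Matrix ι κ ℝ} {b : ι → ℝ}
    {k : Fin Q} {x : κ → ℝ} (h : IsRidgeArgmin ε A b k x) :
    ridgeCost ε (A k) b x ≤ ⨅ k' : Fin Q, ⨅ x' : κ → ℝ, ridgeCost ε (A k') b x' :=
  have : Nonempty (Fin Q) := ⟨k⟩
  le_ciInf fun k' => le_ciInf fun x' => h k' x'

theorem sqNorm_sub_le (u v : ι → ℝ) : sqNorm (u - v) ≤ 2 * sqNorm u + 2 * sqNorm v := by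
  simp only [sqNorm_eq_sum, Finset.mul_sum, ← Finset.sum_add_distrib, Pi.sub_apply]
  exact Finset.sum_le_sum fun i _ => by nlinarith [sq_nonneg (u i + v i)]

theorem sqNorm_le_add_sqNorm_sub (u v : ι → ℝ) :
    sqNorm u ≤ 8 * sqNorm v + 8 / 7 * sqNorm (u - v) := by
  simp only [sqNorm_eq_sum, Finset.mul_sum, ← Finset.sum_add_distrib, Pi.sub_apply]
  exact Finset.sum_le_sum fun i _ => by nlinarith [sq_nonneg (u i - 8 * v i)]

/-- If the sketch `S` preserves the ridge form of `[A, A']` from below up to the factor `3 / 4` and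
does not inflate the residual of the reference solution `x'` of `A'` by more than `5 / (4 δ)`, then
a solution of `A` that is at least as good in the sketched problem has cost at most `9 + 8 / δ`
times that of the reference. -/
theorem ridgeCost_le_of_sketch {ι' : Type*} [Fintype ι'] {ε δ : ℝ} (hε : 0 ≤ ε) (hδ : 0 < δ)
    {A A' : Matrix ι κ ℝ} {b : ι → ℝ} {S : Matrix ι' ι ℝ} {x x' : κ → ℝ}
    (hemb : ∀ α : κ ⊕ κ → ℝ, 3 / 4 * (sqNorm (fromCols A A' *ᵥ α) + ε * sqNorm α) ≤
      sqNorm (S *ᵥ (fromCols A A' *ᵥ α)) + ε * sqNorm α)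
    (hres : sqNorm (S *ᵥ (A' *ᵥ x' - b)) ≤ sqNorm (A' *ᵥ x' - b) / (4 / 5 * δ))
    (hmin : ridgeCost ε (S * A) (S *ᵥ b) x ≤ ridgeCost ε (S * A') (S *ᵥ b) x') :
    ridgeCost ε A b x ≤ (9 + 8 / δ) * ridgeCost ε A' b x' := by
  set u := A *ᵥ x - b with hu
  set v := A' *ᵥ x' - b with hv
  have h1 := hemb (Sum.elim x (-x'))
  have h2 : fromCols A A' *ᵥ Sum.elim x (-x') = u - v := by
    rw [Matrix.fromCols_mulVec_sumElim, Matrix.mulVec_neg, hu, hv]; abel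
  have h3 : sqNorm (Sum.elim x (-x')) = sqNorm x + sqNorm x' := by
    simp [sqNorm_eq_sum]
  have h4 : ∀ (B : Matrix ι κ ℝ) y, (S * B) *ᵥ y - S *ᵥ b = S *ᵥ (B *ᵥ y - b) := fun B y => by
    rw [Matrix.mulVec_sub, Matrix.mulVec_mulVec]
  simp only [ridgeCost, h4, ← hu, ← hv] at hmin ⊢
  rw [h2, h3, Matrix.mulVec_sub] at h1
  have h5 := sqNorm_sub_le (S *ᵥ u) (S *ᵥ v)
  have h6 := sqNorm_le_add_sqNorm_sub u v
  have h7 : sqNorm v / (4 / 5 * δ) = 5 / 4 * (sqNorm v / δ) := by field_simp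
  have h8 : (9 + 8 / δ) * (sqNorm v + ε * sqNorm x') = 9 * sqNorm v + 8 * (sqNorm v / δ) +
      9 * (ε * sqNorm x') + 8 / δ * (ε * sqNorm x') := by field_simp; ring
  have h9 : 0 ≤ sqNorm v / δ := div_nonneg (sqNorm_nonneg v) hδ.le
  have h10 : 0 ≤ ε * sqNorm x := mul_nonneg hε (sqNorm_nonneg x)
  have h11 : 0 ≤ ε * sqNorm x' := mul_nonneg hε (sqNorm_nonneg x')
  have h12 : 0 ≤ 8 / δ * (ε * sqNorm x') := mul_nonneg (by positivity) h11
  have h13 := sqNorm_nonneg v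
  rw [h7] at hres
  rw [h8]
  linarith

/-- Sampling leaves the squared norm of a fixed vector unchanged in expectation, up to the
coordinates that are never sampled. -/
theorem sum_sampleWeight_sqNorm_le {m n : ℕ} (hn : 0 < n) {τ : Fin m → ℝ} (hτ : ∀ i, 0 ≤ τ i)
    (hs : 0 < ∑ i, τ i) (v : Fin m → ℝ) :
    ∑ ρ : Fin n → Fin m, sampleWeight (fun i => τ i / ∑ i', τ i') ρ *
      sqNorm (sampleMatrix τ ρ *ᵥ v) ≤ sqNorm v := by
  have hq1 : ∑ i, τ i / ∑ i', τ i' = 1 := by rw [← Finset.sum_div, div_self hs.ne']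
  simp only [sqNorm_sampleMatrix_mulVec hτ]
  rw [sum_sampleWeight_mul_sum hq1 (fun i => (∑ i, τ i) / (n * τ i) * v i ^ 2), sqNorm_eq_sum,
    Finset.mul_sum]
  refine Finset.sum_le_sum fun i _ => ?_
  have hn' : (0 : ℝ) < n := by exact_mod_cast hn
  rcases (hτ i).eq_or_lt with h | h
  · rw [← h]; simpa using sq_nonneg (v i)
  · refine le_of_eq ?_
    field_simp

end Regression

end MultipleDesigns

end

theorem mainTheorem4 :
    ∃ C : ℝ, 0 < C ∧
      ∀ (Q m d n : ℕ) (_hQ : 0 < Q)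
        (A : Fin Q → Matrix (Fin m) (Fin d) ℝ) (b : Fin m → ℝ)
        (ε : ℝ) (_hε : 0 ≤ ε) (δ : ℝ) (_hδ0 : 0 < δ) (_hδ1 : δ < 1)
        (τ : Fin m → ℝ)
        (_hτ : ∀ (j k : Fin Q) (i : Fin m),
          MultipleDesigns.ridgeLeverage ε (Matrix.fromCols (A j) (A k)) i ≤ τ i)
        (_hs : 0 < ∑ i, τ i)
        (_hn : C * ((∑ i, τ i) * max 1 (Real.log ((∑ i, τ i) / δ * Q))) ≤ n)
        (Ω : Type*) [MeasurableSpace Ω] (μ : Measure Ω) [IsProbabilityMeasure μ]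
        (r : Fin n → Ω → Fin m) (_hr : MultipleDesigns.IsRowSample μ τ r),
        1 - δ ≤ μ.real {ω |
          let S := MultipleDesigns.sampleMatrix τ (fun j => r j ω)
          (∃ (k : Fin Q) (x : Fin d → ℝ),
            MultipleDesigns.IsRidgeArgmin ε (fun k => S * A k) (S *ᵥ b) k x) ∧
          ∀ (k : Fin Q) (x : Fin d → ℝ),
            MultipleDesigns.IsRidgeArgmin ε (fun k => S * A k) (S *ᵥ b) k x →
            MultipleDesigns.ridgeCost ε (A k) b x ≤
              (9 + 8 / δ) *
                ⨅ k' : Fin Q, ⨅ x' : Fin d → ℝ, MultipleDesigns.ridgeCost ε (A k') b x'} := by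
  open MultipleDesigns in
  -- `640 = 5 * 128` bounds each embedding failure by `3 s exp (-5 L)`, where `s ≤ δ exp L / Q`
  refine ⟨640, by norm_num, ?_⟩
  intro Q m d n hQ A b ε hε δ hδ0 hδ1 τ hτ hs hn Ω _ μ _ r hr
  set s := ∑ i, τ i with hs'
  set L := max 1 (Real.log (s / δ * Q)) with hL
  have hQ' : (0 : ℝ) < Q := by exact_mod_cast hQ
  have hL1 : 1 ≤ L := le_max_left _ _
  have hτ0 : ∀ i, 0 ≤ τ i := fun i =>
    (ridgeLeverage_nonneg hε _ i).trans (hτ ⟨0, hQ⟩ ⟨0, hQ⟩ i)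
  have hq : ∀ i, 0 ≤ τ i / s := fun i => div_nonneg (hτ0 i) hs.le
  have hq1 : ∑ i, τ i / s = 1 := by rw [← Finset.sum_div, div_self hs.ne']
  have hsL : s ≤ s * L := le_mul_of_one_le_right hs.le hL1
  have hn192 : 192 * s ≤ n := by linarith
  have hn0 : 0 < n := by
    have : (0 : ℝ) < n := by linarith
    exact_mod_cast this
  -- a solution of the full problem, fixed before sampling
  obtain ⟨k₀, x₀, h₀⟩ := exists_isRidgeArgmin hQ hε A b
  -- the two bad events: some design is not embedded jointly with `A k₀`, or the residual of the
  -- fixed solution is inflated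
  set E : Fin Q → Set (Fin n → Fin m) := fun k => {ρ | ∃ α : Fin d ⊕ Fin d → ℝ,
    sqNorm (sampleMatrix τ ρ *ᵥ (fromCols (A k) (A k₀) *ᵥ α)) + ε * sqNorm α <
      3 / 4 * (sqNorm (fromCols (A k) (A k₀) *ᵥ α) + ε * sqNorm α)} with hE
  set F : Set (Fin n → Fin m) := {ρ | sqNorm (A k₀ *ᵥ x₀ - b) / (4 / 5 * δ) <
    sqNorm (sampleMatrix τ ρ *ᵥ (A k₀ *ᵥ x₀ - b))} with hF
  have hEprob : ∀ k, sampleProb (fun i => τ i / s) (E k) ≤ δ / 5 / Q := by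
    intro k
    refine (sampleProb_not_embedding_le hε _ (hτ k k₀) hs hn192).trans ?_
    have h1 : s / δ * Q ≤ Real.exp L := by
      rw [← Real.log_le_iff_le_exp (by positivity)]
      exact le_max_right _ _
    have h2 : 5 * L ≤ n / (128 * s) := by
      rw [le_div_iff₀ (by positivity)]
      linarith
    have h3 : Real.exp (-(n / (128 * s))) ≤ Real.exp (-(5 * L)) := Real.exp_le_exp.2 (by linarith)
    have h4 : Real.exp L * Real.exp (-(5 * L)) ≤ 1 / 16 := by
      rw [← Real.exp_add]
      have h5 : Real.exp (L + -(5 * L)) ≤ Real.exp (-4) := Real.exp_le_exp.2 (by linarith)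
      have h6 : (16 : ℝ) ≤ Real.exp 4 := by
        have h7 := Real.add_one_le_exp (1 : ℝ)
        have h8 : Real.exp 4 = Real.exp 1 ^ 4 := by rw [← Real.exp_nat_mul]; norm_num
        rw [h8]
        calc (16 : ℝ) = 2 ^ 4 := by norm_num
          _ ≤ _ := pow_le_pow_left₀ (by norm_num) (by linarith) 4
      refine h5.trans ?_
      rw [Real.exp_neg, ← one_div]
      exact one_div_le_one_div_of_le (by norm_num) h6
    have h5 : s ≤ δ / Q * Real.exp L := by
      have h6 := mul_le_mul_of_nonneg_left h1 (by positivity : 0 ≤ δ / Q)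
      calc s = δ / Q * (s / δ * Q) := by field_simp
        _ ≤ _ := h6
    calc 3 * s * Real.exp (-(n / (128 * s)))
        ≤ 3 * (δ / Q * Real.exp L) * Real.exp (-(5 * L)) := by gcongr
      _ = 3 * (δ / Q) * (Real.exp L * Real.exp (-(5 * L))) := by ring
      _ ≤ 3 * (δ / Q) * (1 / 16) := by gcongr
      _ ≤ δ / Q * (1 / 5) := by nlinarith [div_pos hδ0 hQ']
      _ = δ / 5 / Q := by field_simp
  have hFprob : sampleProb (fun i => τ i / s) F ≤ 4 / 5 * δ :=
    sampleProb_lt_le hq (fun ρ => sqNorm_nonneg _) (by positivity) (sqNorm_nonneg _)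
      (sum_sampleWeight_sqNorm_le hn0 hτ0 hs _)
  have hbad : sampleProb (fun i => τ i / s) ((⋃ k, E k) ∪ F) ≤ δ := by
    have h1 := sampleProb_union_le hq (⋃ k, E k) F
    have h2 := sampleProb_iUnion_le hq E
    have h3 : ∑ k, sampleProb (fun i => τ i / s) (E k) ≤ δ / 5 := by
      refine (Finset.sum_le_sum fun k _ => hEprob k).trans (le_of_eq ?_)
      rw [Finset.sum_const, Finset.card_univ, Fintype.card_fin, nsmul_eq_mul]
      field_simp
    linarith
  have hgood : 1 - δ ≤ sampleProb (fun i => τ i / s) ((⋃ k, E k) ∪ F)ᶜ := by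
    rw [sampleProb_compl hq1]; linarith
  rw [← measureReal_eq_sampleProb hr] at hgood
  refine hgood.trans (measureReal_mono ?_)
  intro ω hω
  simp only [Set.mem_ofPred_eq, Set.mem_compl_iff, Set.mem_union, Set.mem_iUnion, not_or,
    not_exists] at hω
  obtain ⟨hωE, hωF⟩ := hω
  refine ⟨exists_isRidgeArgmin hQ hε _ _, fun k x hkx => ?_⟩
  have hcost := ridgeCost_le_of_sketch hε hδ0 (S := sampleMatrix τ fun j => r j ω)
    (fun α => not_lt.1 fun hlt => hωE k ⟨α, hlt⟩) (not_lt.1 hωF) (hkx k₀ x₀)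
  exact hcost.trans (mul_le_mul_of_nonneg_left h₀.ridgeCost_le_iInf (by positivity))
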